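/- Let $k$ be a field and let $A=\bigoplus_{u\ge 0}A_u$ be a standard graded $k$-algebra, i.e. $A$ is commutative, $A_0=k$ and $A$ is generated over $k$ by finitely many elements of degree $1$. Let $I=(f_1,\dots,f_r)$ be a homogeneous ideal of $A$, where $f_j$ is homogeneous of degree $d_j\ge 0$, and put $d=\max\{d_1,\dots,d_r\}$ (with $d=0$ if $r=0$). Let $0:I^\infty$ be the ideal of all elements of $A$ annihilated by some power of $I$, and put $s=\dim A/(0:I^\infty)-1$, where $\dim$ is Krull dimension and the zero ring has dimension $0$. Bigrade the Rees algebra $A[It]=\bigoplus_{v\ge 0}I^vt^v\subseteq A[t]$ by $A[It]_{(u,v)}=(I^v)_u\,t^v$, where $(I^v)_u=I^v\cap A_u$, and let $H_{A[It]}(u,v)=\dim_k A[It]_{(u,v)}$. Then there exist integers $u_0,v_0$ and a polynomial $P_{A[It]}\in\mathbb{Q}[u,v]$ such that $H_{A[It]}(u,v)=P_{A[It]}(u,v)$ for all $u,v\in\mathbb{N}$ with $u\ge dv+u_0$ and $v\ge v_0$, and $$\deg P_{A[It]}(u,v)=\deg_u P_{A[It]}(u,v)=s,$$ where $\deg$ is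 the total degree, $\deg_u$ is the degree in $u$, and the zero polynomial has degree $-1$. Moreover, if $s\ge 0$ and one writes $$P_{A[It]}(u,v)=\sum_{i=0}^{s}\frac{e_i(A[It])}{i!\,(s-i)!}\,u^iv^{s-i}+\text{terms of total degree}<s,$$ then $e_i(A[It])$ is an integer for $i=0,\dots,s$, and $e_s(A[It])=e(A/(0:I^\infty))$, the multiplicity of the graded ring $A/(0:I^\infty)$, that is, $s!$ times the coefficient of $u^s$ in its Hilbert polynomial (the polynomial which agrees with $\dim_k (A/(0:I^\infty))_u$ for all large $u$, and which has degree $s$). -/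

import Mathlib

namespace BigradedRees

open Filter

/-- `A`, graded by `𝒜`, is a standard graded algebra over the field `k`: `A₀ = k` and `A` is
generated as a `k`-algebra by finitely many elements of degree one. -/
structure IsStandardGraded {k A : Type*} [Field k] [CommRing A] [Algebra k A]
    (𝒜 : ℕ → Submodule k A) [GradedAlgebra 𝒜] : Prop where
  nontrivial : Nontrivial A
  zero_eq : 𝒜 0 = 1
  finite_one : Module.Finite k (𝒜 1)
  adjoin_one : Algebra.adjoin k (𝒜 1 : Set A) = ⊤

/-- The ideal `0 : I^∞` of the elements annihilated by some power of `I`. -/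
def zeroColonInfty {A : Type*} [CommRing A] (I : Ideal A) : Ideal A where
  carrier := {a | ∃ m : ℕ, ∀ b ∈ I ^ m, b * a = 0}
  zero_mem' := ⟨0, fun b _ => mul_zero b⟩
  add_mem' := by
    rintro x y ⟨m, hm⟩ ⟨n, hn⟩
    refine ⟨m + n, fun b hb => ?_⟩
    rw [mul_add, hm b (Ideal.pow_le_pow_right (Nat.le_add_right m n) hb),
      hn b (Ideal.pow_le_pow_right (Nat.le_add_left n m) hb), add_zero]
  smul_mem' := by
    rintro c x ⟨m, hm⟩
    refine ⟨m, fun b hb => ?_⟩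
    rw [smul_eq_mul, mul_left_comm, hm b hb, mul_zero]

/-- The Krull dimension of a ring of finite Krull dimension as a natural number, with the
convention that the zero ring has dimension `0`. -/
noncomputable def krullDim (R : Type*) [CommRing R] : ℕ :=
  ((ringKrullDim R).unbotD 0).toNat

section Hilbert

variable {k A : Type*} [Field k] [CommRing A] [Algebra k A]

/-- The homogeneous component `A[It]_(u,v) = (I^v)_u t^v` of the Rees algebra `A[It] ⊆ A[t]`:
the elements of `A[It]` of the form `a t^v` with `a` homogeneous of degree `u`
(then `a ∈ I^v`, as the element lies in `A[It]`). -/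
noncomputable def reesComponent (𝒜 : ℕ → Submodule k A) (I : Ideal A) (u v : ℕ) :
    Submodule k (reesAlgebra I) :=
  ((𝒜 u).map ((Polynomial.monomial v : A →ₗ[A] Polynomial A).restrictScalars k)).comap
    ((reesAlgebra I).val.toLinearMap.restrictScalars k)

/-- The Hilbert function `H_{A[It]}(u,v) = dim_k A[It]_(u,v)`. -/
noncomputable def reesHilbert (𝒜 : ℕ → Submodule k A) (I : Ideal A) (u v : ℕ) : ℕ :=
  Module.finrank k (reesComponent 𝒜 I u v)

/-- The Hilbert function `u ↦ dim_k (A/J)_u` of the quotient `A/J`, where `(A/J)_u` is the image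
of the component of degree `u` of `A`. -/
noncomputable def quotientHilbert (𝒜 : ℕ → Submodule k A) (J : Ideal A) (u : ℕ) : ℕ :=
  Module.finrank k ((𝒜 u).map (Ideal.Quotient.mkₐ k J).toLinearMap)

open Classical in
/-- The polynomial with rational coefficients that agrees with `H` at all large integers
(it is unique if it exists; the value is `0` if there is none). -/
noncomputable def hilbertPolynomial (H : ℕ → ℕ) : Polynomial ℚ :=
  if h : ∃ Q : Polynomial ℚ, ∀ᶠ u in atTop, (H u : ℚ) = Q.eval (u : ℚ) then h.choose else 0

open Classical in
/-- The multiplicity `e(A/J)` of the quotient of a standard graded algebra by a homogeneous ideal: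
`q!` times the leading coefficient of the Hilbert polynomial, `q` being its degree; if the Hilbert
polynomial vanishes, i.e. if `A/J` has finite length, the length of `A/J`. -/
noncomputable def quotientMultiplicity (𝒜 : ℕ → Submodule k A) (J : Ideal A) : ℚ :=
  let Q := hilbertPolynomial (quotientHilbert 𝒜 J)
  if Q = 0 then (Module.finrank k (A ⧸ J) : ℚ)
  else (Q.natDegree.factorial : ℚ) * Q.leadingCoeff

end Hilbert

section Polynomials

open Classical in
/-- The total degree of a polynomial in `u` (variable `0`) and `v` (variable `1`), the zero
polynomial having degree `-1`. -/
noncomputable def totalDeg (P : MvPolynomial (Fin 2) ℚ) : ℤ :=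
  if P = 0 then -1 else (P.totalDegree : ℤ)

open Classical in
/-- The degree in `u` (variable `0`), the zero polynomial having degree `-1`. -/
noncomputable def uDeg (P : MvPolynomial (Fin 2) ℚ) : ℤ :=
  if P = 0 then -1 else (P.degreeOf 0 : ℤ)

/-- The number `e_i`, `i ≤ s`, if a polynomial `P` of total degree `s` is written as
`∑_{i ≤ s} e_i / (i! (s - i)!) u^i v^(s - i)` plus terms of lower degree. -/
noncomputable def mixedMultiplicity (P : MvPolynomial (Fin 2) ℚ) (i : ℕ) : ℚ :=
  (i.factorial : ℚ) * ((P.totalDegree - i).factorial : ℚ) *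
    P.coeff (Finsupp.single 0 i + Finsupp.single 1 (P.totalDegree - i))

end Polynomials

end BigradedRees

namespace BigradedRees

open Filter

/-! ### Additivity of Hilbert functions along a homogeneous element -/

section GradedHilbert

/-! Write `J = 0 : I^∞`, and let `Q` be the Hilbert polynomial of `A/J`.

Existence of `P`. The Rees algebra is a quotient of `S = k[X, T]` with `deg X_i = (1, 0)` and `deg
T_j = (d_j, 1)`, so it suffices to treat `S/L` for every homogeneous ideal `L`, by Noetherian
induction. If all `T_j` lie in `L`, the Hilbert function vanishes for `v ≥ 1`. Otherwise choose `T_j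
∉ L`: the Hilbert function of `S/L` is that of `S/(L + T_j)` plus the shift by `(d_j, 1)` of that of
`S/(L : T_j)`. Either both ideals are larger than `L`, or `L : T_j = L` and one obtains a difference
equation in the direction `(d_j, 1)`, solved from a boundary row. The region `u ≥ dv + u₀` is
preserved when stepping back along that direction because `d_j ≤ d`
(`exists_mvPolynomial_gradedHilbert`).

Degree and leading coefficient. By Artin–Rees, `I^v ∩ J = 0` for large `v`, so `H_{A/J}(u) = H_{A/(J
+ I^v)}(u) + H_{A[It]}(u, v)`. Some element of `I` is a nonzerodivisor on `A/J`, so `A/(J + I^v)`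
has smaller dimension. Hence for fixed large `v` the polynomial `P(u, v)` has the same leading term
in `u` as `Q`. Moreover `0 ≤ P(u, v) ≤ Q(u)` on the region, which bounds the total degree by `deg Q`
after restriction to rays (`degrees_eq_of_bounds`). Noether normalization identifies `deg Q + 1`
with the Krull dimension (`IsStandardGraded.ringKrullDim_quotient_eq`), and integrality of the `e_i`
comes from iterated differences of integer values (`exists_int_of_integer_valued`). -/

theorem finrank_map_eq_of_ker {k M M₁ M₂ : Type*} [Field k] [AddCommGroup M] [Module k M]
    [AddCommGroup M₁] [Module k M₁] [AddCommGroup M₂] [Module k M₂] (U : Submodule k M)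
    (f : M →ₗ[k] M₁) (g : M →ₗ[k] M₂) (h : ∀ x ∈ U, f x = 0 ↔ g x = 0) :
    Module.finrank k (U.map f) = Module.finrank k (U.map g) := by
  have hk : LinearMap.ker (f.domRestrict U) = LinearMap.ker (g.domRestrict U) := by
    ext x
    simpa using h x x.2
  rw [← LinearMap.range_domRestrict, ← LinearMap.range_domRestrict,
    ← (f.domRestrict U).quotKerEquivRange.finrank_eq,
    ← (g.domRestrict U).quotKerEquivRange.finrank_eq, hk]

theorem finrank_map_add_finrank_inf_ker {k M M₁ : Type*} [Field k] [AddCommGroup M] [Module k M]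
    [AddCommGroup M₁] [Module k M₁] (U : Submodule k M) [FiniteDimensional k U]
    (f : M →ₗ[k] M₁) :
    Module.finrank k (U.map f) + Module.finrank k (U ⊓ LinearMap.ker f : Submodule k M) =
      Module.finrank k U := by
  have h := (f.domRestrict U).finrank_range_add_finrank_ker
  rw [LinearMap.range_domRestrict] at h
  rw [← h]
  congr 1
  have : (LinearMap.ker (f.domRestrict U)).map U.subtype = U ⊓ LinearMap.ker f := by
    ext x
    simp only [Submodule.mem_map, LinearMap.mem_ker, LinearMap.domRestrict_apply,
      Submodule.subtype_apply, Subtype.exists, Submodule.mem_inf]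
    constructor
    · rintro ⟨a, ha, h0, rfl⟩
      exact ⟨ha, h0⟩
    · rintro ⟨ha, h0⟩
      exact ⟨x, ha, h0, rfl⟩
  rw [← this]
  exact (Submodule.equivMapOfInjective _ U.injective_subtype _).finrank_eq.symm

variable {k B ι : Type*} [Field k] [CommRing B] [Algebra k B]

/-- The Hilbert function of the quotient of a graded algebra by an ideal. -/
noncomputable def gradedHilbert (ℬ : ι → Submodule k B) (J : Ideal B) (i : ι) : ℕ :=
  Module.finrank k ((ℬ i).map (Ideal.Quotient.mkₐ k J).toLinearMap)

theorem gradedHilbert_eq_zero (ℬ : ι → Submodule k B) (J : Ideal B) (i : ι)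
    (h : ∀ b ∈ ℬ i, b ∈ J) : gradedHilbert ℬ J i = 0 := by
  have : (ℬ i).map (Ideal.Quotient.mkₐ k J).toLinearMap = ⊥ := by
    rw [eq_bot_iff]
    rintro _ ⟨b, hb, rfl⟩
    simpa [Ideal.Quotient.eq_zero_iff_mem] using h b hb
  rw [gradedHilbert, this, finrank_bot]

/-- The colon ideal of an ideal by an element. -/
def colonElem (J : Ideal B) (t : B) : Ideal B := Submodule.comap (LinearMap.mulLeft B t) J

theorem mem_colonElem {J : Ideal B} {t b : B} : b ∈ colonElem J t ↔ t * b ∈ J := Iff.rfl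

theorem le_colonElem (J : Ideal B) (t : B) : J ≤ colonElem J t := fun _ hb =>
  J.mul_mem_left t hb

variable [AddCancelCommMonoid ι] [DecidableEq ι] (ℬ : ι → Submodule k B) [GradedAlgebra ℬ]

theorem isHomogeneous_colonElem {J : Ideal B} (hJ : J.IsHomogeneous ℬ) {t : B} {w : ι}
    (ht : t ∈ ℬ w) : (colonElem J t).IsHomogeneous ℬ := by
  intro i b hb
  rw [mem_colonElem, ← DirectSum.coe_decompose_mul_add_of_left_mem ℬ ht]
  exact hJ _ hb

theorem isHomogeneous_sup_span {J : Ideal B} (hJ : J.IsHomogeneous ℬ) {t : B} {w : ι}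
    (ht : t ∈ ℬ w) : (J ⊔ Ideal.span {t}).IsHomogeneous ℬ :=
  hJ.sup (Ideal.homogeneous_span _ _ (by rintro x rfl; exact ⟨w, ht⟩))

/-- Multiplication by `t` gives the exact sequence `0 → B/(J : t) → B/J → B/(J + t) → 0`, of degree
`w` on the left; this is its dimension count in degree `w + c`. -/
theorem gradedHilbert_add {J : Ideal B} (hJ : J.IsHomogeneous ℬ) {t : B} {w : ι}
    (ht : t ∈ ℬ w) (c : ι) [FiniteDimensional k (ℬ (w + c))] :
    gradedHilbert ℬ J (w + c) =
      gradedHilbert ℬ (J ⊔ Ideal.span {t}) (w + c) + gradedHilbert ℬ (colonElem J t) c := by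
  set V := (ℬ (w + c)).map (Ideal.Quotient.mkₐ k J).toLinearMap with hV
  set f : B ⧸ J →ₗ[k] B ⧸ (J ⊔ Ideal.span {t}) :=
    (Ideal.Quotient.factorₐ k (le_sup_left : J ≤ J ⊔ Ideal.span {t})).toLinearMap with hf
  have hfm : ∀ b : B, f (Ideal.Quotient.mkₐ k J b) =
      Ideal.Quotient.mkₐ k (J ⊔ Ideal.span {t}) b := fun b => rfl
  have h1 : V.map f = (ℬ (w + c)).map (Ideal.Quotient.mkₐ k (J ⊔ Ideal.span {t})).toLinearMap := by
    rw [hV, ← Submodule.map_comp]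
    rfl
  have h2 : V ⊓ LinearMap.ker f = (ℬ c).map
      ((Ideal.Quotient.mkₐ k J).toLinearMap ∘ₗ LinearMap.mulLeft k t) := by
    ext x
    constructor
    · rintro ⟨⟨b, hb, rfl⟩, hx⟩
      have hx' : b ∈ J ⊔ Ideal.span {t} := by
        have : f (Ideal.Quotient.mkₐ k J b) = 0 := hx
        rw [hfm] at this
        exact Ideal.Quotient.eq_zero_iff_mem.1 this
      obtain ⟨j, hj, y, hy, hjy⟩ := Submodule.mem_sup.1 hx'
      obtain ⟨z, rfl⟩ := Ideal.mem_span_singleton.1 hy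
      -- Since `b` is homogeneous of degree `w + c`, only the component of `z` in degree `c`
      -- contributes, by cancellation in `ι`.
      refine ⟨DirectSum.decompose ℬ z c, SetLike.coe_mem _, ?_⟩
      have e : b = DirectSum.decompose ℬ j (w + c) + t * DirectSum.decompose ℬ z c := by
        rw [← DirectSum.coe_decompose_mul_add_of_left_mem ℬ ht,
          ← DirectSum.decompose_of_mem_same ℬ hb, ← hjy, DirectSum.decompose_add]
        simp
      have hj' : Ideal.Quotient.mkₐ k J (DirectSum.decompose ℬ j (w + c)) = 0 :=
        Ideal.Quotient.eq_zero_iff_mem.2 (hJ _ hj)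
      change Ideal.Quotient.mkₐ k J (t * DirectSum.decompose ℬ z c) = Ideal.Quotient.mkₐ k J b
      conv_rhs => rw [e, map_add, hj', zero_add]
    · rintro ⟨b, hb, rfl⟩
      refine ⟨⟨t * b, SetLike.mul_mem_graded ht hb, rfl⟩, ?_⟩
      change f (Ideal.Quotient.mkₐ k J (t * b)) = 0
      rw [hfm]
      exact Ideal.Quotient.eq_zero_iff_mem.2 (Ideal.mul_mem_right _ _
        (Ideal.mem_sup_right (Ideal.mem_span_singleton_self t)))
  have h3 := finrank_map_add_finrank_inf_ker V f
  rw [h1, h2] at h3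
  rw [gradedHilbert, ← h3, gradedHilbert, gradedHilbert]
  congr 1
  apply finrank_map_eq_of_ker
  intro x _
  change Ideal.Quotient.mk J (t * x) = 0 ↔ Ideal.Quotient.mk (colonElem J t) x = 0
  rw [Ideal.Quotient.eq_zero_iff_mem, Ideal.Quotient.eq_zero_iff_mem, mem_colonElem]

end GradedHilbert

/-! ### Eventual polynomiality in one variable -/

section OneVariable

open Polynomial in
theorem exists_polynomial_sub_eq (p : ℚ[X]) :
    ∃ q : ℚ[X], ∀ x : ℚ, q.eval x - q.eval (x - 1) = p.eval x := by
  induction p using Polynomial.induction_on' with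
  | add p₁ p₂ h₁ h₂ =>
    obtain ⟨q₁, h₁⟩ := h₁
    obtain ⟨q₂, h₂⟩ := h₂
    refine ⟨q₁ + q₂, fun x => ?_⟩
    simp only [eval_add, ← h₁, ← h₂]
    ring
  | monomial n a =>
    -- The Bernoulli polynomials satisfy `B_{n+1}(x + 1) - B_{n+1}(x) = (n + 1) x^n`.
    refine ⟨C (a / (n + 1)) * (Polynomial.bernoulli (n + 1)).comp (X + 1), fun x => ?_⟩
    have h := Polynomial.bernoulli_eval_one_add (n + 1) x
    have hn : (n : ℚ) + 1 ≠ 0 := by positivity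
    simp only [eval_mul, eval_C, eval_comp, eval_add, eval_X, eval_one, eval_monomial,
      sub_add_cancel]
    rw [add_comm x 1, h]
    push_cast
    field_simp
    simp [mul_assoc]

variable {k B ι : Type*} [Field k] [CommRing B] [Algebra k B]
  [AddCancelCommMonoid ι] [DecidableEq ι] (ℬ : ι → Submodule k B) [GradedAlgebra ℬ]

/-- The Hilbert function along a ray in a direction in which the algebra is generated is
eventually polynomial. -/
theorem exists_polynomial_gradedHilbert [IsNoetherianRing B]
    (hfin : ∀ i, FiniteDimensional k (ℬ i)) (w c : ι) (X : Set B) (hX : ∀ x ∈ X, x ∈ ℬ w)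
    (hgen : ∀ᶠ n : ℕ in atTop, ∀ b ∈ ℬ (c + n • w), b ∈ Ideal.span X)
    (J : Ideal B) (hJ : J.IsHomogeneous ℬ) :
    ∃ Q : Polynomial ℚ, ∀ᶠ n : ℕ in atTop,
      (gradedHilbert ℬ J (c + n • w) : ℚ) = Q.eval (n : ℚ) := by
  revert hJ
  refine IsNoetherian.induction (R := B) (M := B)
    (P := fun J : Ideal B => J.IsHomogeneous ℬ → ∃ Q : Polynomial ℚ, ∀ᶠ n : ℕ in atTop,
      (gradedHilbert ℬ J (c + n • w) : ℚ) = Q.eval (n : ℚ)) ?_ J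
  intro J ih hJ
  by_cases hXJ : X ⊆ J
  · refine ⟨0, hgen.mono fun n hn => ?_⟩
    rw [gradedHilbert_eq_zero ℬ J _ fun b hb => Ideal.span_le.2 hXJ (hn b hb)]
    simp
  obtain ⟨x, hxX, hxJ⟩ := Set.not_subset.1 hXJ
  have hx := hX x hxX
  have key : ∀ n : ℕ, gradedHilbert ℬ J (c + (n + 1) • w) =
      gradedHilbert ℬ (J ⊔ Ideal.span {x}) (c + (n + 1) • w) +
        gradedHilbert ℬ (colonElem J x) (c + n • w) := by
    intro n
    have e : c + (n + 1) • w = w + (c + n • w) := by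
      rw [succ_nsmul]; abel
    rw [e]
    exact gradedHilbert_add ℬ hJ hx _
  obtain ⟨Q₁, h₁⟩ := ih (J ⊔ Ideal.span {x})
    (lt_of_le_of_ne le_sup_left fun h => hxJ (by
      rw [h]; exact Ideal.mem_sup_right (Ideal.mem_span_singleton_self x)))
    (isHomogeneous_sup_span ℬ hJ hx)
  -- If `x` is a nonzerodivisor modulo `J`, the induction says nothing about the colon ideal;
  -- instead `key` prescribes the successive differences of the Hilbert function, and its value at
  -- `N` fixes the constant of summation.
  by_cases hc : colonElem J x = J
  · obtain ⟨q, hq⟩ := exists_polynomial_sub_eq Q₁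
    obtain ⟨N, hN⟩ := eventually_atTop.1 h₁
    refine ⟨q + Polynomial.C ((gradedHilbert ℬ J (c + N • w) : ℚ) - q.eval (N : ℚ)),
      eventually_atTop.2 ⟨N, fun n hn => ?_⟩⟩
    induction n, hn using Nat.le_induction with
    | base => simp
    | succ n hn IH =>
      have h2 := hq ((n + 1 : ℕ) : ℚ)
      rw [← hN (n + 1) (by lia)] at h2
      rw [key, hc]
      push_cast at h2 ⊢
      rw [IH]
      simp only [Polynomial.eval_add, Polynomial.eval_C]
      rw [← h2, add_sub_cancel_right]
      ring
  · obtain ⟨Q₂, h₂⟩ := ih (colonElem J x) (lt_of_le_of_ne (le_colonElem J x) (Ne.symm hc))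
      (isHomogeneous_colonElem ℬ hJ hx)
    refine ⟨Q₁ + Q₂.comp (Polynomial.X - 1), ?_⟩
    obtain ⟨N₁, h₁⟩ := eventually_atTop.1 h₁
    obtain ⟨N₂, h₂⟩ := eventually_atTop.1 h₂
    refine eventually_atTop.2 ⟨N₁ + N₂ + 1, fun n hn => ?_⟩
    obtain ⟨n, rfl⟩ : ∃ m, n = m + 1 := ⟨n - 1, by lia⟩
    rw [key, Nat.cast_add, h₁ _ (by lia), h₂ _ (by lia)]
    simp

end OneVariable

/-! ### Difference equations in two variables -/

section TwoVariables

open MvPolynomial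

theorem eval_bind₁_pair (P g₀ g₁ : MvPolynomial (Fin 2) ℚ) (x : Fin 2 → ℚ) :
    eval x (bind₁ ![g₀, g₁] P) = eval ![eval x g₀, eval x g₁] P := by
  have h := eval₂Hom_bind₁ (RingHom.id ℚ) x ![g₀, g₁] P
  have e : (fun i => eval₂Hom (RingHom.id ℚ) x (![g₀, g₁] i)) = ![eval x g₀, eval x g₁] := by
    funext i
    fin_cases i <;> rfl
  rw [e] at h
  exact h

theorem eval_pair_aeval (p : Polynomial ℚ) (g : MvPolynomial (Fin 2) ℚ) (x : Fin 2 → ℚ) :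
    eval x (Polynomial.aeval g p) = p.eval (eval x g) := by
  rw [Polynomial.aeval_def, Polynomial.hom_eval₂, ← Polynomial.eval₂_id]
  congr 1
  exact Subsingleton.elim _ _

theorem exists_mvPolynomial_sub_eq (P : MvPolynomial (Fin 2) ℚ) (δ : ℚ) :
    ∃ Q : MvPolynomial (Fin 2) ℚ, ∀ u v : ℚ,
      eval ![u, v] Q - eval ![u - δ, v - 1] Q = eval ![u, v] P := by
  have key : ∀ P : MvPolynomial (Fin 2) ℚ, ∃ Q : MvPolynomial (Fin 2) ℚ, ∀ u v : ℚ,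
      eval ![u, v] Q - eval ![u, v - 1] Q = eval ![u, v] P := by
    intro P
    induction P using MvPolynomial.induction_on' with
    | add p₁ p₂ h₁ h₂ =>
      obtain ⟨q₁, h₁⟩ := h₁
      obtain ⟨q₂, h₂⟩ := h₂
      refine ⟨q₁ + q₂, fun u v => ?_⟩
      simp only [eval_add, ← h₁, ← h₂]
      ring
    | monomial m a =>
      obtain ⟨q, hq⟩ := exists_polynomial_sub_eq (Polynomial.X ^ m 1)
      refine ⟨C a * X 0 ^ m 0 * Polynomial.aeval (X 1) q, fun u v => ?_⟩
      have h := hq v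
      rw [Polynomial.eval_pow, Polynomial.eval_X] at h
      rw [eval_monomial, Finsupp.prod_fintype _ _ (by simp), Fin.prod_univ_two]
      simp only [eval_mul, eval_C, eval_pow, eval_X, eval_pair_aeval, Matrix.cons_val_zero,
        Matrix.cons_val_one]
      rw [← h]
      ring
  -- The shear `(u, v) ↦ (u + δ v, v)` turns the step `(δ, 1)` into `(0, 1)`.
  obtain ⟨Q, hQ⟩ := key (bind₁ ![X 0 + C δ * X 1, X 1] P)
  refine ⟨bind₁ ![X 0 - C δ * X 1, X 1] Q, fun u v => ?_⟩
  have h := hQ (u - δ * v) v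
  simp only [eval_bind₁_pair, eval_add, eval_sub, eval_mul, eval_C, eval_X,
    Matrix.cons_val_zero, Matrix.cons_val_one, sub_add_cancel] at h ⊢
  rw [← h]
  congr 3
  ring_nf

end TwoVariables

/-! ### Eventual polynomiality on a cone in the bigraded case -/

section Bigraded

variable {k B : Type*} [Field k] [CommRing B] [Algebra k B]
  (ℬ : ℕ × ℕ → Submodule k B) [GradedAlgebra ℬ]

theorem exists_mvPolynomial_gradedHilbert [IsNoetherianRing B]
    (hfin : ∀ i, FiniteDimensional k (ℬ i)) {κ : Type*} (T : κ → B) (δ : κ → ℕ)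
    (hT : ∀ j, T j ∈ ℬ (δ j, 1)) (d : ℕ) (hd : ∀ j, δ j ≤ d)
    (hgen : ∀ u v : ℕ, ∀ b ∈ ℬ (u, v + 1), b ∈ Ideal.span (Set.range T))
    (hrow : ∀ J : Ideal B, J.IsHomogeneous ℬ → ∀ v : ℕ, ∃ Q : Polynomial ℚ,
      ∀ᶠ u : ℕ in atTop, (gradedHilbert ℬ J (u, v) : ℚ) = Q.eval (u : ℚ))
    (J : Ideal B) (hJ : J.IsHomogeneous ℬ) :
    ∃ (P : MvPolynomial (Fin 2) ℚ) (u₀ v₀ : ℕ), ∀ u v : ℕ, d * v + u₀ ≤ u → v₀ ≤ v →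
      (gradedHilbert ℬ J (u, v) : ℚ) = MvPolynomial.eval ![(u : ℚ), (v : ℚ)] P := by
  revert hJ
  refine IsNoetherian.induction (R := B) (M := B)
    (P := fun J : Ideal B => J.IsHomogeneous ℬ →
      ∃ (P : MvPolynomial (Fin 2) ℚ) (u₀ v₀ : ℕ), ∀ u v : ℕ, d * v + u₀ ≤ u → v₀ ≤ v →
      (gradedHilbert ℬ J (u, v) : ℚ) = MvPolynomial.eval ![(u : ℚ), (v : ℚ)] P) ?_ J
  intro J ih hJ
  by_cases hTJ : Set.range T ⊆ J
  · refine ⟨0, 0, 1, fun u v _ hv => ?_⟩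
    obtain ⟨v, rfl⟩ : ∃ m, v = m + 1 := ⟨v - 1, by lia⟩
    rw [gradedHilbert_eq_zero ℬ J _ fun b hb => Ideal.span_le.2 hTJ (hgen u v b hb)]
    simp
  obtain ⟨_, ⟨j, rfl⟩, hjJ⟩ := Set.not_subset.1 hTJ
  have key : ∀ u v : ℕ, gradedHilbert ℬ J (u + δ j, v + 1) =
      gradedHilbert ℬ (J ⊔ Ideal.span {T j}) (u + δ j, v + 1) +
        gradedHilbert ℬ (colonElem J (T j)) (u, v) := by
    intro u v
    have e : (u + δ j, v + 1) = (δ j, 1) + (u, v) := by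
      ext <;> simp [add_comm]
    rw [e]
    exact gradedHilbert_add ℬ hJ (hT j) _
  obtain ⟨P₁, u₁, v₁, h₁⟩ := ih (J ⊔ Ideal.span {T j})
    (lt_of_le_of_ne le_sup_left fun h => hjJ (by
      rw [h]; exact Ideal.mem_sup_right (Ideal.mem_span_singleton_self _)))
    (isHomogeneous_sup_span ℬ hJ (hT j))
  have hdj := hd j
  by_cases hc : colonElem J (T j) = J
  · obtain ⟨Q, hQ⟩ := exists_mvPolynomial_sub_eq P₁ (δ j)
    obtain ⟨R, hR⟩ := hrow J hJ v₁
    obtain ⟨N, hN⟩ := eventually_atTop.1 hR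
    -- The line through `(u, v)` in direction `(δ j, 1)` meets the row `v₁` at `u - δ j (v - v₁)`.
    -- The correction to the particular solution `Q` is constant along such lines and equals `R - Q`
    -- on that row.
    refine ⟨Q + Polynomial.aeval (MvPolynomial.X 0 -
        MvPolynomial.C (δ j : ℚ) * (MvPolynomial.X 1 - MvPolynomial.C (v₁ : ℚ))) R -
      MvPolynomial.bind₁ ![MvPolynomial.X 0 -
        MvPolynomial.C (δ j : ℚ) * (MvPolynomial.X 1 - MvPolynomial.C (v₁ : ℚ)),
        MvPolynomial.C (v₁ : ℚ)] Q, N + u₁, v₁, fun u v hu hv => ?_⟩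
    induction v, hv using Nat.le_induction generalizing u with
    | base =>
      rw [hN u (by lia)]
      simp [eval_bind₁_pair, eval_pair_aeval]
    | succ v hv IH =>
      -- Since `δ j ≤ d`, the point `(u - δ j, v)` still satisfies the inequality of the cone.
      have hmul : d * (v + 1) = d * v + d := by ring
      obtain ⟨u, rfl⟩ : ∃ m, u = m + δ j := ⟨u - δ j, by lia⟩
      have h2 := hQ ((u + δ j : ℕ) : ℚ) ((v + 1 : ℕ) : ℚ)
      rw [← h₁ _ _ (by lia) (by lia)] at h2
      rw [key, hc, Nat.cast_add, ← h2, IH u (by lia)]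
      simp only [MvPolynomial.eval_add, MvPolynomial.eval_sub, MvPolynomial.eval_mul,
        MvPolynomial.eval_C, MvPolynomial.eval_X, eval_bind₁_pair, eval_pair_aeval,
        Matrix.cons_val_zero, Matrix.cons_val_one]
      have e : ((u + δ j : ℕ) : ℚ) - δ j * (((v + 1 : ℕ) : ℚ) - v₁) =
        (u : ℚ) - δ j * ((v : ℚ) - v₁) := by push_cast; ring
      rw [e]
      push_cast
      simp only [add_sub_cancel_right]
      ring
  · obtain ⟨P₂, u₂, v₂, h₂⟩ := ih (colonElem J (T j))
      (lt_of_le_of_ne (le_colonElem J _) (Ne.symm hc)) (isHomogeneous_colonElem ℬ hJ (hT j))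
    refine ⟨P₁ + MvPolynomial.bind₁ ![MvPolynomial.X 0 - MvPolynomial.C (δ j : ℚ),
      MvPolynomial.X 1 - 1] P₂, u₁ + u₂, v₁ + v₂ + 1, fun u v hu hv => ?_⟩
    obtain ⟨v, rfl⟩ : ∃ m, v = m + 1 := ⟨v - 1, by lia⟩
    have hmul : d * (v + 1) = d * v + d := by ring
    obtain ⟨u, rfl⟩ : ∃ m, u = m + δ j := ⟨u - δ j, by lia⟩
    rw [key, Nat.cast_add, h₁ _ _ (by lia) (by lia), h₂ _ _ (by lia) (by lia)]
    simp [eval_bind₁_pair]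

end Bigraded

/-! ### Krull dimension as rate of growth -/

section Growth

/-- Incomparability gives one inequality; lying over and going up lift chains for the other. -/
theorem ringKrullDim_eq_of_isIntegral {R S : Type*} [CommRing R] [CommRing S] [Algebra R S]
    [Algebra.IsIntegral R S] (hinj : Function.Injective (algebraMap R S)) :
    ringKrullDim S = ringKrullDim R := by
  apply le_antisymm
  · refine Order.krullDim_le_of_strictMono (PrimeSpectrum.comap (algebraMap R S)) ?_
    intro P Q hPQ
    exact Ideal.IsIntegral.comap_lt_comap (R := R) (I := P.asIdeal) (J := Q.asIdeal) hPQ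
  · refine iSup_le fun l => ?_
    obtain ⟨P, -, hP, hPl⟩ := Ideal.exists_ideal_over_prime_of_isIntegral (S := S)
      l.head.asIdeal ⊥ (by
        rw [← RingHom.ker_eq_comap_bot, (RingHom.injective_iff_ker_eq_bot _).1 hinj]
        exact bot_le)
    have : P.LiesOver l.head.asIdeal := ⟨hPl.symm⟩
    obtain ⟨L, hL, -, -⟩ := Ideal.exists_ltSeries_of_hasGoingUp l P
    rw [← hL]
    exact Order.LTSeries.length_le_krullDim L

variable {k R : Type*} [Field k] [CommRing R] [Algebra k R]

theorem pow_le_pow_of_one_mem {W : Submodule k R} (h1 : (1 : R) ∈ W) {m n : ℕ} (h : m ≤ n) :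
    W ^ m ≤ W ^ n :=
  pow_le_pow_right' (Submodule.one_le.2 h1) h

theorem exists_mem_pow_of_adjoin_eq_top {W : Submodule k R} (h1 : (1 : R) ∈ W)
    (hW : Algebra.adjoin k (W : Set R) = ⊤) (x : R) : ∃ n, x ∈ W ^ n := by
  have hx : x ∈ Algebra.adjoin k (W : Set R) := hW ▸ Algebra.mem_top
  induction hx using Algebra.adjoin_induction with
  | mem x hx => exact ⟨1, by simpa using hx⟩
  | algebraMap r => exact ⟨0, by rw [pow_zero]; exact Submodule.algebraMap_mem r⟩
  | add x y _ _ hx hy =>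
    obtain ⟨m, hm⟩ := hx
    obtain ⟨n, hn⟩ := hy
    exact ⟨m + n, add_mem (pow_le_pow_of_one_mem h1 (Nat.le_add_right m n) hm)
      (pow_le_pow_of_one_mem h1 (Nat.le_add_left n m) hn)⟩
  | mul x y _ _ hx hy =>
    obtain ⟨m, hm⟩ := hx
    obtain ⟨n, hn⟩ := hy
    exact ⟨m + n, by rw [pow_add]; exact Submodule.mul_mem_mul hm hn⟩

/-- The monomials form a box. Bounding each exponent rather than the total degree makes the
dimension an exact power, at the price of constant factors only. -/
theorem finrank_restrictDegree (k : Type*) [Field k] (D m : ℕ) :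
    Module.finrank k (MvPolynomial.restrictDegree (Fin D) k m) = (m + 1) ^ D := by
  rw [MvPolynomial.restrictDegree, Module.finrank_eq_nat_card_basis (MvPolynomial.basisRestrictSupport k
    {n : Fin D →₀ ℕ | ∀ i, n i ≤ m})]
  have e : {n : Fin D →₀ ℕ // ∀ i, n i ≤ m} ≃ (Fin D → {a : ℕ // a ≤ m}) :=
    (Finsupp.equivFunOnFinite.subtypeEquiv (q := fun n : Fin D → ℕ => ∀ i, n i ≤ m)
      fun n => Iff.rfl).trans (Equiv.subtypePiEquivPi (p := fun _ a => a ≤ m))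
  have e' : {a : ℕ // a ≤ m} ≃ Fin (m + 1) :=
    (Equiv.subtypeEquivRight fun a => by rw [Nat.lt_succ_iff]).trans Fin.equivSubtype.symm
  rw [Set.coe_ofPred, Nat.card_congr e, Nat.card_pi]
  simp [Nat.card_congr e']

theorem finrank_mul_le (M N : Submodule k R) [FiniteDimensional k M] [FiniteDimensional k N] :
    Module.finrank k (M * N : Submodule k R) ≤ Module.finrank k M * Module.finrank k N := by
  rw [← Module.finrank_tensorProduct (R := k) (S := k)]
  exact LinearMap.finrank_le_finrank_of_surjective (Submodule.mulMap'_surjective M N)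

theorem map_restrictDegree_le_pow {D : ℕ} (g : MvPolynomial (Fin D) k →ₐ[k] R)
    {W : Submodule k R} (h1 : (1 : R) ∈ W) {c : ℕ} (hc : ∀ i, g (MvPolynomial.X i) ∈ W ^ c)
    (m : ℕ) :
    (MvPolynomial.restrictDegree (Fin D) k m).map g.toLinearMap ≤ W ^ (c * D * m) := by
  rw [MvPolynomial.restrictDegree, MvPolynomial.restrictSupport_eq_span, Submodule.map_span,
    Submodule.span_le]
  rintro _ ⟨_, ⟨n, hn, rfl⟩, rfl⟩
  have key : ∀ s : Finset (Fin D),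
      ∏ i ∈ s, g (MvPolynomial.X i) ^ n i ∈ W ^ (∑ i ∈ s, c * n i) := by
    intro s
    induction s using Finset.induction_on with
    | empty => exact Submodule.one_le.1 le_rfl
    | insert a s ha ih =>
      rw [Finset.prod_insert ha, Finset.sum_insert ha, pow_add, pow_mul]
      exact Submodule.mul_mem_mul (Submodule.pow_mem_pow _ (hc a) _) ih
  have e : g.toLinearMap (MvPolynomial.monomial n 1) =
      ∏ i, g (MvPolynomial.X i) ^ n i := by
    rw [AlgHom.toLinearMap_apply, MvPolynomial.monomial_eq, MvPolynomial.C_1, one_mul,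
      Finsupp.prod_fintype _ _ (by simp), map_prod]
    simp
  rw [SetLike.mem_coe, e]
  refine pow_le_pow_of_one_mem h1 ?_ (key Finset.univ)
  rw [← Finset.mul_sum, mul_assoc]
  refine Nat.mul_le_mul_left c ?_
  calc ∑ i, n i ≤ ∑ _i : Fin D, m := Finset.sum_le_sum fun i _ => hn i
    _ = D * m := by simp

theorem restrictDegree_mul_le (σ : Type*) (m n : ℕ) :
    MvPolynomial.restrictDegree σ k m * MvPolynomial.restrictDegree σ k n ≤
      MvPolynomial.restrictDegree σ k (m + n) := by
  rw [MvPolynomial.restrictDegree, MvPolynomial.restrictDegree, ← MvPolynomial.restrictSupport_add]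
  refine MvPolynomial.restrictSupport_mono _ ?_
  rintro _ ⟨a, ha, b, hb, rfl⟩ i
  exact Nat.add_le_add (ha i) (hb i)

theorem restrictDegree_le (σ : Type*) {m n : ℕ} (h : m ≤ n) :
    MvPolynomial.restrictDegree σ k m ≤ MvPolynomial.restrictDegree σ k n :=
  MvPolynomial.restrictSupport_mono _ fun _ ha i => (ha i).trans h

theorem exists_mem_restrictDegree {σ : Type*} (p : MvPolynomial σ k) :
    ∃ m, p ∈ MvPolynomial.restrictDegree σ k m :=
  ⟨p.totalDegree, MvPolynomial.restrictTotalDegree_le_restrictDegree _ _ _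
    ((MvPolynomial.mem_restrictTotalDegree _ _ _).2 le_rfl)⟩

theorem one_mem_restrictDegree (σ : Type*) :
    (1 : MvPolynomial σ k) ∈ MvPolynomial.restrictDegree σ k 0 := by
  classical
  rw [MvPolynomial.mem_restrictDegree]
  intro a ha i
  by_contra hai
  refine (MvPolynomial.mem_support_iff.1 ha) ?_
  rw [MvPolynomial.coeff_one, if_neg]
  rintro rfl
  simp at hai

/-- The powers of a finite dimensional generating subspace of a finitely generated algebra grow
like a polynomial whose degree is the Krull dimension. -/
theorem exists_growth_bounds [Nontrivial R] {W : Submodule k R} [FiniteDimensional k W]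
    (h1 : (1 : R) ∈ W) (hW : Algebra.adjoin k (W : Set R) = ⊤) :
    ∃ D c l : ℕ, ringKrullDim R = D ∧ 0 < c ∧
      (∀ m, (m + 1) ^ D ≤ Module.finrank k (W ^ (c * m) : Submodule k R)) ∧
      (∀ m, Module.finrank k (W ^ m : Submodule k R) ≤ l * (c * m + 1) ^ D) := by
  classical
  have hWfg : W.FG := Module.Finite.iff_fg.1 inferInstance
  have hft : Algebra.FiniteType k R := by
    obtain ⟨s, hs⟩ := hWfg
    refine ⟨⟨s, ?_⟩⟩
    rw [eq_top_iff, ← hW]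
    refine Algebra.adjoin_le ?_
    rw [← hs]
    exact Algebra.span_le_adjoin k _
  -- Noether normalization: `R` is finite over a polynomial ring in `D` variables, whence `D = dim
  -- R`, and both growth bounds come from comparison with that ring.
  obtain ⟨D, g, hinj, hgfin⟩ := exists_finite_inj_algHom_of_fg k R
  have hdim : ringKrullDim R = D := by
    let := g.toRingHom.toAlgebra
    have : Module.Finite (MvPolynomial (Fin D) k) R := hgfin
    have := ringKrullDim_eq_of_isIntegral (R := MvPolynomial (Fin D) k) (S := R) hinj
    rw [this, MvPolynomial.ringKrullDim_of_isNoetherianRing, ringKrullDim_eq_zero_of_field]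
    simp
  have hpowfin : ∀ n, FiniteDimensional k (W ^ n : Submodule k R) := fun n =>
    Module.Finite.iff_fg.2 (hWfg.pow n)
  obtain ⟨c₁, hc₁⟩ : ∃ c, ∀ i, g (MvPolynomial.X i) ∈ W ^ c := by
    choose n hn using fun i => exists_mem_pow_of_adjoin_eq_top h1 hW (g (MvPolynomial.X i))
    exact ⟨Finset.univ.sup n, fun i =>
      pow_le_pow_of_one_mem h1 (Finset.le_sup (Finset.mem_univ i)) (hn i)⟩
  obtain ⟨s, hs⟩ : ∃ s : Finset R, ∀ x : R, ∃ n, x ∈ Submodule.span k (s : Set R) *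
      (MvPolynomial.restrictDegree (Fin D) k n).map g.toLinearMap := by
    let := g.toRingHom.toAlgebra
    have : Module.Finite (MvPolynomial (Fin D) k) R := hgfin
    obtain ⟨s, hs⟩ : (⊤ : Submodule (MvPolynomial (Fin D) k) R).FG := Module.Finite.fg_top
    refine ⟨s, fun x => ?_⟩
    have hx : x ∈ Submodule.span (MvPolynomial (Fin D) k) (s : Set R) := hs ▸ Submodule.mem_top
    induction hx using Submodule.span_induction with
    | mem x hx =>
      refine ⟨0, ?_⟩
      rw [← mul_one x]
      exact Submodule.mul_mem_mul (Submodule.subset_span hx)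
        ⟨1, one_mem_restrictDegree _, map_one g⟩
    | zero => exact ⟨0, zero_mem _⟩
    | add x y _ _ hx hy =>
      obtain ⟨m, hm⟩ := hx
      obtain ⟨n, hn⟩ := hy
      exact ⟨m + n, add_mem
        (mul_le_mul' le_rfl (Submodule.map_mono
          (restrictDegree_le _ (Nat.le_add_right m n))) hm)
        (mul_le_mul' le_rfl (Submodule.map_mono
          (restrictDegree_le _ (Nat.le_add_left n m))) hn)⟩
    | smul p x _ hx =>
      obtain ⟨n, hn⟩ := hx
      obtain ⟨m, hm⟩ := exists_mem_restrictDegree p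
      refine ⟨n + m, ?_⟩
      have e : p • x = x * g p := by
        rw [Algebra.smul_def, mul_comm]
        rfl
      rw [e]
      refine mul_le_mul' le_rfl (Submodule.map_mono (restrictDegree_mul_le _ n m)) ?_
      rw [Submodule.map_mul, ← mul_assoc]
      exact Submodule.mul_mem_mul hn ⟨p, hm, rfl⟩
  -- The element `1` is added to the module generators so that `W ^ n ≤ W ^ n * M`.
  set M := Submodule.span k (insert 1 s : Set R) with hM
  have hMfg : M.FG := Submodule.fg_span (s.finite_toSet.insert 1)
  have hMfin : FiniteDimensional k M := Module.Finite.iff_fg.2 hMfg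
  set E : ℕ → Submodule k R := fun n =>
    (MvPolynomial.restrictDegree (Fin D) k n).map g.toLinearMap with hE
  have hEmul : ∀ m n, E m * E n ≤ E (m + n) := fun m n => by
    rw [hE]
    simp only
    rw [← Submodule.map_mul]
    exact Submodule.map_mono (restrictDegree_mul_le _ m n)
  have hEmono : ∀ {m n}, m ≤ n → E m ≤ E n := fun h => Submodule.map_mono (restrictDegree_le _ h)
  have h1E : (1 : R) ∈ E 0 := ⟨1, one_mem_restrictDegree _, map_one g⟩
  -- `W * M` is finite dimensional, so one degree bound works for all its elements: each factor `W`
  -- moved past `M` raises the degree by at most `c₂`.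
  obtain ⟨c₂, hc₂⟩ : ∃ c, W * M ≤ M * E c := by
    obtain ⟨t, ht⟩ := hWfg.mul hMfg
    choose n hn using hs
    refine ⟨t.sup n, ?_⟩
    rw [← ht, Submodule.span_le]
    intro x hx
    exact mul_le_mul' (Submodule.span_mono (Set.subset_insert _ _))
      (hEmono (Finset.le_sup hx)) (hn x)
  have hWn : ∀ n, W ^ n * M ≤ M * E (c₂ * n) := by
    intro n
    induction n with
    | zero =>
      rw [pow_zero, one_mul]
      exact le_mul_of_one_le_right' (Submodule.one_le.2 h1E)
    | succ n ih =>
      calc W ^ (n + 1) * M = W ^ n * (W * M) := by rw [pow_succ, mul_assoc]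
        _ ≤ W ^ n * (M * E c₂) := mul_le_mul' le_rfl hc₂
        _ = (W ^ n * M) * E c₂ := by rw [mul_assoc]
        _ ≤ (M * E (c₂ * n)) * E c₂ := mul_le_mul' ih le_rfl
        _ = M * (E (c₂ * n) * E c₂) := by rw [mul_assoc]
        _ ≤ M * E (c₂ * (n + 1)) := by
          rw [mul_add_one]
          exact mul_le_mul' le_rfl (hEmul _ _)
  -- One constant dominates both `c₁ * D` (lower bound) and `c₂` (upper bound); the `+ 1` makes it
  -- positive.
  refine ⟨D, c₁ * D + c₂ + 1, Module.finrank k M, hdim, Nat.succ_pos _, fun m => ?_, fun m => ?_⟩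
  · rw [← finrank_restrictDegree k D m]
    rw [(Submodule.equivMapOfInjective g.toLinearMap hinj _).finrank_eq]
    refine Submodule.finrank_mono ((map_restrictDegree_le_pow g h1 hc₁ m).trans ?_)
    exact pow_le_pow_of_one_mem h1 (Nat.mul_le_mul_right m (by lia))
  · calc Module.finrank k (W ^ m : Submodule k R)
        ≤ Module.finrank k (M * E (c₂ * m) : Submodule k R) := by
          have : FiniteDimensional k (M * E (c₂ * m) : Submodule k R) :=
            Module.Finite.iff_fg.2 (hMfg.mul (Module.Finite.iff_fg.1 inferInstance))
          refine Submodule.finrank_mono (le_trans ?_ (hWn m))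
          calc W ^ m = W ^ m * 1 := (mul_one _).symm
            _ ≤ W ^ m * M := mul_le_mul' le_rfl
              (Submodule.one_le.2 (Submodule.subset_span (Set.mem_insert _ _)))
      _ ≤ Module.finrank k M * Module.finrank k (E (c₂ * m)) := finrank_mul_le _ _
      _ ≤ Module.finrank k M * ((c₁ * D + c₂ + 1) * m + 1) ^ D := by
          refine Nat.mul_le_mul_left _ ?_
          rw [← (Submodule.equivMapOfInjective g.toLinearMap hinj _).finrank_eq,
            finrank_restrictDegree]
          exact Nat.pow_le_pow_left (Nat.succ_le_succ (Nat.mul_le_mul_right m (by lia))) D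

end Growth

/-! ### Degrees of polynomials from inequalities and differences -/

section PolynomialGrowth

open Polynomial

theorem eq_of_eventually_eval_eq {p q : ℚ[X]}
    (h : ∀ᶠ n : ℕ in atTop, p.eval (n : ℚ) = q.eval (n : ℚ)) : p = q := by
  obtain ⟨N, hN⟩ := eventually_atTop.1 h
  refine eq_of_infinite_eval_eq p q (Set.Infinite.mono ?_
    ((Set.Ici_infinite N).image (Nat.cast_injective (R := ℚ)).injOn))
  rintro _ ⟨n, hn, rfl⟩
  exact hN n hn

/-- If `deg q < deg p`, then `q = o(p)`, so eventually `0 ≤ p ≤ q ≤ p / 2`, which forces `p = 0`. -/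
theorem natDegree_le_of_eventually_le {p q : ℚ[X]}
    (h : ∀ᶠ n : ℕ in atTop, 0 ≤ p.eval (n : ℚ) ∧ p.eval (n : ℚ) ≤ q.eval (n : ℚ)) :
    p.natDegree ≤ q.natDegree := by
  by_contra! hlt
  have ho := ((isLittleO_atTop_of_degree_lt _ _ (degree_lt_degree hlt)).comp_tendsto
    (tendsto_natCast_atTop_atTop (R := ℚ))).bound (show (0 : ℝ) < 1 / 2 by norm_num)
  have h0 : p = 0 := by
    apply eq_of_eventually_eval_eq
    filter_upwards [h, ho] with n ⟨h1, h2⟩ h3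
    simp only [Function.comp_apply] at h3
    rw [← Rat.norm_cast_real, ← Rat.norm_cast_real, Real.norm_of_nonneg (Rat.cast_nonneg.2 h1),
      Real.norm_of_nonneg (Rat.cast_nonneg.2 (h1.trans h2))] at h3
    have h4 : ((p.eval (n : ℚ) : ℚ) : ℝ) ≤ (q.eval (n : ℚ) : ℚ) := by exact_mod_cast h2
    have h5 : (0 : ℝ) ≤ (p.eval (n : ℚ) : ℚ) := by exact_mod_cast h1
    have h6 : ((p.eval (n : ℚ) : ℚ) : ℝ) = 0 := by linarith
    rw [eval_zero]
    exact_mod_cast h6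
  rw [h0] at hlt
  simp at hlt

/-- The `n`-th difference of a polynomial of degree `n` is a nonzero constant when the polynomial is
nonzero, and higher differences vanish; so the degree can be read off from iterated differences. -/
theorem natDegree_eq_of_sub_eq {q Q : ℚ[X]} (hQ : Q ≠ 0)
    (h : ∀ x : ℚ, q.eval x - q.eval (x - 1) = Q.eval x) : q.natDegree = Q.natDegree + 1 := by
  set Q' := Q.comp (X + 1) with hQ'
  have hdeg : Q'.natDegree = Q.natDegree := by
    rw [hQ', natDegree_comp, ← C_1, natDegree_X_add_C, mul_one]
  have hlead : Q'.leadingCoeff ≠ 0 := by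
    rw [hQ', leadingCoeff_comp (by rw [← C_1, natDegree_X_add_C]; exact one_ne_zero)]
    rw [← C_1, leadingCoeff_X_add_C, one_pow, mul_one]
    exact leadingCoeff_ne_zero.2 hQ
  have hd : fwdDiff 1 (fun x => q.eval x) = fun x => Q'.eval x := by
    funext x
    rw [fwdDiff, hQ', eval_comp, ← h]
    simp
  have h1 : (fwdDiff (1 : ℚ))^[Q.natDegree + 1] (fun x => q.eval x) =
      Q'.leadingCoeff • (Q.natDegree.factorial : ℚ → ℚ) := by
    rw [Function.iterate_succ_apply, hd, ← hdeg]
    exact fwdDiff_iter_degree_eq_factorial Q'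
  have h2 : (fwdDiff (1 : ℚ))^[Q.natDegree + 2] (fun x => q.eval x) = 0 := by
    rw [Function.iterate_succ_apply, hd, ← hdeg]
    exact fwdDiff_iter_degree_add_one_eq_zero Q'
  apply le_antisymm
  · by_contra! hlt
    obtain ⟨m, hm⟩ := Nat.exists_eq_add_of_lt hlt
    have h3 := fwdDiff_iter_degree_eq_factorial q
    have e : q.natDegree = m + (Q.natDegree + 2) := by lia
    have h4 : (fwdDiff (1 : ℚ))^[q.natDegree] (fun x => q.eval x) = 0 := by
      rw [e, Function.iterate_add_apply, h2]
      funext x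
      rw [fwdDiff_iter_eq_sum_shift]
      simp
    have h5 := congrFun (h3.symm.trans h4) 0
    simp only [Pi.smul_apply, smul_eq_mul, Pi.zero_apply, Pi.natCast_apply, mul_eq_zero,
      Nat.cast_eq_zero, Nat.factorial_ne_zero, or_false, leadingCoeff_eq_zero] at h5
    rw [h5] at hlt
    simp at hlt
  · by_contra! hlt
    have h5 := congrFun (h1.symm.trans (fwdDiff_iter_eq_zero_of_degree_lt hlt)) 0
    simp only [Pi.smul_apply, smul_eq_mul, Pi.zero_apply, Pi.natCast_apply, mul_eq_zero,
      Nat.cast_eq_zero, Nat.factorial_ne_zero, or_false] at h5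
    exact hlead h5

theorem natDegree_eq_of_growth_bounds {p : ℚ[X]} {G : ℕ → ℕ} {D c l : ℕ}
    (hp : ∀ᶠ n : ℕ in atTop, (G n : ℚ) = p.eval (n : ℚ)) (hc : 0 < c)
    (hl : ∀ m, (m + 1) ^ D ≤ G (c * m)) (hu : ∀ m, G m ≤ l * (c * m + 1) ^ D) :
    p.natDegree = D := by
  have hlin : ∀ a : ℚ, a ≠ 0 → (C a * X + 1 : ℚ[X]).natDegree = 1 := fun a ha => by
    rw [← C_1, natDegree_linear ha]
  apply le_antisymm
  · calc p.natDegree ≤ (C (l : ℚ) * (C (c : ℚ) * X + 1) ^ D).natDegree := by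
          apply natDegree_le_of_eventually_le
          filter_upwards [hp] with n hn
          rw [← hn]
          refine ⟨Nat.cast_nonneg _, ?_⟩
          have := hu n
          simp only [eval_mul, eval_C, eval_pow, eval_add, eval_X, eval_one]
          exact_mod_cast this
      _ ≤ ((C (c : ℚ) * X + 1 : ℚ[X]) ^ D).natDegree := natDegree_C_mul_le _ _
      _ ≤ D := by
          refine natDegree_pow_le.trans ?_
          rw [hlin _ (by exact_mod_cast hc.ne'), mul_one]
  -- The lower bound concerns only multiples of `c`; the dilation `X ↦ c X` does not change the
  -- degree of `p`.
  · calc D = ((X + 1 : ℚ[X]) ^ D).natDegree := by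
          rw [natDegree_pow, ← C_1, natDegree_X_add_C, mul_one]
      _ ≤ (p.comp (C (c : ℚ) * X)).natDegree := by
          apply natDegree_le_of_eventually_le
          have ht : Tendsto (fun n : ℕ => c * n) atTop atTop :=
            tendsto_atTop_mono (fun n => Nat.le_mul_of_pos_left n hc) tendsto_id
          filter_upwards [ht.eventually hp] with n hn
          have := hl n
          simp only [eval_pow, eval_add, eval_X, eval_one, eval_comp, eval_mul, eval_C]
          rw [← Nat.cast_mul, ← hn]
          refine ⟨by positivity, ?_⟩
          exact_mod_cast this
      _ = p.natDegree := by
          rw [natDegree_comp, natDegree_C_mul_X _ (by exact_mod_cast hc.ne'), mul_one]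

end PolynomialGrowth

/-! ### Dimension and Hilbert polynomial of standard graded quotients -/

section StandardGraded

variable {k A : Type*} [Field k] [CommRing A] [Algebra k A] {𝒜 : ℕ → Submodule k A}
  [GradedAlgebra 𝒜]

theorem IsStandardGraded.pow_one_le (𝒜 : ℕ → Submodule k A) [GradedAlgebra 𝒜] (n : ℕ) :
    𝒜 1 ^ n ≤ 𝒜 n := by
  induction n with
  | zero =>
    rw [pow_zero, Submodule.one_le]
    exact SetLike.one_mem_graded 𝒜
  | succ n ih =>
    rw [pow_succ, Submodule.mul_le]
    intro a ha b hb
    exact SetLike.mul_mem_graded (ih ha) hb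

theorem IsStandardGraded.eq_pow_one (hA : IsStandardGraded 𝒜) (n : ℕ) : 𝒜 n = 𝒜 1 ^ n := by
  apply le_antisymm _ (pow_one_le 𝒜 n)
  have key : ∀ x : A, ∀ n, (DirectSum.decompose 𝒜 x n : A) ∈ 𝒜 1 ^ n := by
    intro x
    have hx : x ∈ Submodule.span k (Submonoid.closure (𝒜 1 : Set A) : Set A) := by
      rw [← Algebra.adjoin_eq_span, hA.adjoin_one]
      exact (Algebra.mem_top : x ∈ (⊤ : Subalgebra k A))
    induction hx using Submodule.span_induction with
    | mem x hx =>
      obtain ⟨m, hm⟩ : ∃ m, x ∈ 𝒜 1 ^ m := by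
        induction hx using Submonoid.closure_induction with
        | mem x hx => exact ⟨1, by simpa using hx⟩
        | one => exact ⟨0, Submodule.one_le.1 (pow_zero (𝒜 1)).ge⟩
        | mul x y _ _ hx hy =>
          obtain ⟨m, hm⟩ := hx
          obtain ⟨n, hn⟩ := hy
          exact ⟨m + n, by rw [pow_add]; exact Submodule.mul_mem_mul hm hn⟩
      intro n
      by_cases h : m = n
      · subst h
        rwa [DirectSum.decompose_of_mem_same 𝒜 (pow_one_le 𝒜 m hm)]
      · rw [DirectSum.decompose_of_mem_ne 𝒜 (pow_one_le 𝒜 m hm) h]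
        exact zero_mem _
    | zero => intro n; simp
    | add x y _ _ hx hy =>
      intro n
      rw [DirectSum.decompose_add]
      exact add_mem (hx n) (hy n)
    | smul a x _ hx =>
      intro n
      rw [DirectSum.decompose_smul]
      exact Submodule.smul_mem _ _ (hx n)
  intro x hx
  have := key x n
  rwa [DirectSum.decompose_of_mem_same 𝒜 hx] at this

theorem IsStandardGraded.finiteDimensional (hA : IsStandardGraded 𝒜) (n : ℕ) :
    FiniteDimensional k (𝒜 n) := by
  rw [hA.eq_pow_one]
  exact Module.Finite.iff_fg.2 ((Module.Finite.iff_fg.1 hA.finite_one).pow n)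

theorem IsStandardGraded.finiteType (hA : IsStandardGraded 𝒜) : Algebra.FiniteType k A := by
  obtain ⟨s, hs⟩ := Module.Finite.iff_fg.1 hA.finite_one
  refine ⟨⟨s, ?_⟩⟩
  rw [eq_top_iff, ← hA.adjoin_one]
  refine Algebra.adjoin_le ?_
  rw [← hs]
  exact Algebra.span_le_adjoin k _

theorem IsStandardGraded.isNoetherianRing (hA : IsStandardGraded 𝒜) : IsNoetherianRing A :=
  have := hA.finiteType
  Algebra.FiniteType.isNoetherianRing k A

theorem IsStandardGraded.mem_span_one (hA : IsStandardGraded 𝒜) {n : ℕ} {a : A}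
    (ha : a ∈ 𝒜 (n + 1)) : a ∈ Ideal.span (𝒜 1 : Set A) := by
  rw [hA.eq_pow_one, pow_succ] at ha
  induction ha using Submodule.mul_induction_on' with
  | mem_mul_mem x _ y hy => exact Ideal.mul_mem_left _ _ (Ideal.subset_span hy)
  | add x _ y _ hx hy => exact add_mem hx hy

theorem IsStandardGraded.exists_hilbertPolynomial (hA : IsStandardGraded 𝒜) {J : Ideal A}
    (hJ : J.IsHomogeneous 𝒜) :
    ∃ Q : Polynomial ℚ, ∀ᶠ n : ℕ in atTop, (gradedHilbert 𝒜 J n : ℚ) = Q.eval (n : ℚ) := by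
  have := hA.isNoetherianRing
  obtain ⟨Q, hQ⟩ := exists_polynomial_gradedHilbert 𝒜 hA.finiteDimensional 1 0 (𝒜 1 : Set A)
    (fun x hx => hx) (eventually_atTop.2 ⟨1, fun n hn b hb => by
      obtain ⟨m, rfl⟩ : ∃ m, n = m + 1 := ⟨n - 1, by lia⟩
      refine hA.mem_span_one (n := m) ?_
      simpa using hb⟩) J hJ
  exact ⟨Q, by simpa using hQ⟩

/-- For `V = 𝒜 1` this exhibits the filtration by degree: each power of `1 ⊔ 𝒜 1` adds one graded
component. -/
theorem one_sup_pow_succ (V : Submodule k A) (n : ℕ) :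
    (1 ⊔ V) ^ (n + 1) = (1 ⊔ V) ^ n ⊔ V ^ (n + 1) := by
  induction n with
  | zero => simp
  | succ n ih =>
    have h1 : (1 ⊔ V) ^ n * V ≤ (1 ⊔ V) ^ (n + 1) := by
      rw [pow_succ]
      exact mul_le_mul' le_rfl le_sup_right
    calc (1 ⊔ V) ^ (n + 1 + 1) = (1 ⊔ V) ^ (n + 1) ⊔ (1 ⊔ V) ^ (n + 1) * V := by
          rw [pow_succ _ (n + 1), Submodule.mul_sup, mul_one]
      _ = (1 ⊔ V) ^ (n + 1) ⊔ ((1 ⊔ V) ^ n * V ⊔ V ^ (n + 1 + 1)) := by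
          congr 1
          rw [ih, Submodule.sup_mul, ← pow_succ]
      _ = (1 ⊔ V) ^ (n + 1) ⊔ V ^ (n + 1 + 1) := by
          rw [← sup_assoc, sup_eq_left.2 h1]

theorem decompose_eq_zero_of_mem_pow (𝒜 : ℕ → Submodule k A) [GradedAlgebra 𝒜] {n m : ℕ}
    (hnm : n < m) {x : A} (hx : x ∈ (1 ⊔ 𝒜 1) ^ n) : (DirectSum.decompose 𝒜 x m : A) = 0 := by
  induction n generalizing x with
  | zero =>
    have h0 : x ∈ 𝒜 0 := IsStandardGraded.pow_one_le 𝒜 0 (by simpa using hx)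
    exact DirectSum.decompose_of_mem_ne 𝒜 h0 (by lia)
  | succ n ih =>
    rw [one_sup_pow_succ] at hx
    obtain ⟨y, hy, z, hz, rfl⟩ := Submodule.mem_sup.1 hx
    rw [DirectSum.decompose_add, DirectSum.add_apply, Submodule.coe_add, ih (by lia) hy,
      DirectSum.decompose_of_mem_ne 𝒜 (IsStandardGraded.pow_one_le 𝒜 _ hz) (by lia), add_zero]

/-- With `W` the image of `k + A₁`, the dimension of `W ^ n` is the sum of the Hilbert function up
to `n`. It grows with exponent the Krull dimension, while summation raises the degree of a nonzero
`Q` by one and turns `Q = 0` into a constant. -/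
theorem IsStandardGraded.ringKrullDim_quotient_eq (hA : IsStandardGraded 𝒜) {J : Ideal A}
    (hJ : J.IsHomogeneous 𝒜) {Q : Polynomial ℚ}
    (hQ : ∀ᶠ n : ℕ in atTop, (gradedHilbert 𝒜 J n : ℚ) = Q.eval (n : ℚ)) [Nontrivial (A ⧸ J)] :
    ringKrullDim (A ⧸ J) = ((if Q = 0 then 0 else Q.natDegree + 1 : ℕ) : WithBot ℕ∞) := by
  set mk : A →ₐ[k] A ⧸ J := Ideal.Quotient.mkₐ k J with hmk
  set W : Submodule k (A ⧸ J) := (1 ⊔ 𝒜 1).map mk.toLinearMap with hW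
  have hUfg : (1 ⊔ 𝒜 1 : Submodule k A).FG :=
    Submodule.FG.sup (Submodule.one_eq_span (R := k) (A := A) ▸ Submodule.fg_span_singleton 1) (Module.Finite.iff_fg.1 hA.finite_one)
  have hWpow : ∀ n, W ^ n = ((1 ⊔ 𝒜 1) ^ n).map mk.toLinearMap := fun n =>
    (Submodule.map_pow (1 ⊔ 𝒜 1) mk n).symm
  have hWfin : ∀ n, FiniteDimensional k (W ^ n : Submodule k (A ⧸ J)) := fun n => by
    rw [hWpow]
    exact Module.Finite.iff_fg.2 ((hUfg.pow n).map _)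
  have hWfin' : FiniteDimensional k W := by rw [← pow_one W]; exact hWfin 1
  have h1 : (1 : A ⧸ J) ∈ W :=
    ⟨1, Submodule.mem_sup_left (Submodule.one_le.1 le_rfl), map_one mk⟩
  have hadj : Algebra.adjoin k (W : Set (A ⧸ J)) = ⊤ := by
    have h2 : (Algebra.adjoin k (𝒜 1 : Set A)).map mk = ⊤ := by
      rw [hA.adjoin_one, Algebra.map_top, AlgHom.range_eq_top]
      exact Ideal.Quotient.mkₐ_surjective k J
    rw [eq_top_iff, ← h2, AlgHom.map_adjoin]
    refine Algebra.adjoin_mono ?_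
    rintro _ ⟨a, ha, rfl⟩
    exact ⟨a, Submodule.mem_sup_right ha, rfl⟩
  obtain ⟨D, c, l, hD, hc, hl, hu⟩ := exists_growth_bounds h1 hadj
  have hstep : ∀ n, Module.finrank k (W ^ (n + 1) : Submodule k (A ⧸ J)) =
      Module.finrank k (W ^ n : Submodule k (A ⧸ J)) + gradedHilbert 𝒜 J (n + 1) := by
    intro n
    have e : W ^ (n + 1) = W ^ n ⊔ (𝒜 (n + 1)).map mk.toLinearMap := by
      rw [hWpow, hWpow, one_sup_pow_succ, Submodule.map_sup, hA.eq_pow_one (n + 1)]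
    have hdis : W ^ n ⊓ (𝒜 (n + 1)).map mk.toLinearMap = ⊥ := by
      rw [eq_bot_iff, hWpow]
      rintro _ ⟨⟨a, ha, rfl⟩, b, hb, hab⟩
      have h3 : b - a ∈ J := Ideal.Quotient.eq.1 hab
      have h4 := hJ (n + 1) h3
      rw [DirectSum.decompose_sub, DirectSum.sub_apply, Submodule.coe_sub,
        DirectSum.decompose_of_mem_same 𝒜 hb,
        decompose_eq_zero_of_mem_pow 𝒜 (Nat.lt_succ_self n) ha, sub_zero] at h4
      rw [← hab]
      exact Ideal.Quotient.eq_zero_iff_mem.2 h4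
    have hfin : FiniteDimensional k ((𝒜 (n + 1)).map mk.toLinearMap) :=
      have := hA.finiteDimensional (n + 1)
      inferInstance
    have h5 := Submodule.finrank_sup_add_finrank_inf_eq (W ^ n)
      ((𝒜 (n + 1)).map mk.toLinearMap)
    rw [hdis, finrank_bot, add_zero, ← e] at h5
    exact h5
  obtain ⟨q, hq⟩ := exists_polynomial_sub_eq Q
  obtain ⟨N, hN⟩ := eventually_atTop.1 hQ
  set a : ℚ := (Module.finrank k (W ^ N : Submodule k (A ⧸ J)) : ℚ) - q.eval (N : ℚ) with ha
  have hG : ∀ᶠ n : ℕ in atTop, (Module.finrank k (W ^ n : Submodule k (A ⧸ J)) : ℚ) =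
      (q + Polynomial.C a).eval (n : ℚ) := by
    refine eventually_atTop.2 ⟨N, fun n hn => ?_⟩
    induction n, hn using Nat.le_induction with
    | base => simp [ha]
    | succ n hn ih =>
      have h2 := hq ((n + 1 : ℕ) : ℚ)
      rw [← hN (n + 1) (by lia)] at h2
      rw [hstep, Nat.cast_add, ih, ← h2]
      push_cast
      simp only [Polynomial.eval_add, Polynomial.eval_C, add_sub_cancel_right]
      ring
  have hdeg := natDegree_eq_of_growth_bounds hG hc hl hu
  rw [Polynomial.natDegree_add_C] at hdeg
  rw [hD, ← hdeg]
  congr 1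
  split_ifs with h0
  · subst h0
    have : q = Polynomial.C (q.eval 0) := by
      apply eq_of_eventually_eval_eq
      refine Eventually.of_forall fun n => ?_
      rw [Polynomial.eval_C]
      induction n with
      | zero => simp
      | succ n ih =>
        have h2 := hq ((n + 1 : ℕ) : ℚ)
        push_cast at h2 ⊢
        rw [Polynomial.eval_zero, add_sub_cancel_right] at h2
        rw [← ih]
        linarith
    rw [this, Polynomial.natDegree_C]
  · rw [natDegree_eq_of_sub_eq h0 hq]

end StandardGraded

/-! ### Degrees and coefficients of polynomials in two variables -/

section PolynomialAnalysis

open MvPolynomial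

/-- The bivariate exponent `u^i v^j`. -/
noncomputable def expPair (i j : ℕ) : Fin 2 →₀ ℕ := Finsupp.single 0 i + Finsupp.single 1 j

@[simp] theorem expPair_zero (i j : ℕ) : expPair i j 0 = i := by simp [expPair]

@[simp] theorem expPair_one (i j : ℕ) : expPair i j 1 = j := by simp [expPair]

theorem expPair_self (m : Fin 2 →₀ ℕ) : expPair (m 0) (m 1) = m := by
  ext i
  fin_cases i <;> simp

theorem eval_pair_eq (P : MvPolynomial (Fin 2) ℚ) (u v : ℚ) :
    eval ![u, v] P = ∑ m ∈ P.support, P.coeff m * (u ^ m 0 * v ^ m 1) := by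
  rw [eval_eq']
  simp [Fin.prod_univ_two]

/-- The substitution `v = c` as a polynomial in `u`. -/
noncomputable def restrictV (P : MvPolynomial (Fin 2) ℚ) (c : ℚ) : Polynomial ℚ :=
  ∑ m ∈ P.support, Polynomial.C (P.coeff m * c ^ m 1) * Polynomial.X ^ m 0

theorem eval_restrictV (P : MvPolynomial (Fin 2) ℚ) (c u : ℚ) :
    (restrictV P c).eval u = eval ![u, c] P := by
  rw [eval_pair_eq, restrictV, Polynomial.eval_finsetSum]
  refine Finset.sum_congr rfl fun m _ => ?_
  simp only [Polynomial.eval_mul, Polynomial.eval_C, Polynomial.eval_pow, Polynomial.eval_X]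
  ring

/-- The coefficient of `u^i` as a polynomial in `v`. -/
noncomputable def coeffU (P : MvPolynomial (Fin 2) ℚ) (i : ℕ) : Polynomial ℚ :=
  ∑ m ∈ P.support with m 0 = i, Polynomial.monomial (m 1) (P.coeff m)

theorem coeff_coeffU (P : MvPolynomial (Fin 2) ℚ) (i j : ℕ) :
    (coeffU P i).coeff j = P.coeff (expPair i j) := by
  rw [coeffU, Polynomial.finsetSum_coeff]
  simp only [Polynomial.coeff_monomial]
  rw [← Finset.sum_filter, Finset.filter_filter]
  by_cases h : P.coeff (expPair i j) = 0
  · rw [h]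
    refine Finset.sum_eq_zero fun m hm => ?_
    obtain ⟨-, rfl, rfl⟩ := Finset.mem_filter.1 hm
    rwa [expPair_self] at h
  · rw [Finset.sum_eq_single (expPair i j)]
    · intro m hm hne
      obtain ⟨-, rfl, rfl⟩ := Finset.mem_filter.1 hm
      exact absurd (expPair_self m).symm hne
    · intro hm
      simp [h] at hm

theorem coeff_restrictV (P : MvPolynomial (Fin 2) ℚ) (c : ℚ) (i : ℕ) :
    (restrictV P c).coeff i = (coeffU P i).eval c := by
  rw [restrictV, coeffU, Polynomial.finsetSum_coeff, Polynomial.eval_finsetSum,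
    Finset.sum_filter]
  refine Finset.sum_congr rfl fun m _ => ?_
  rw [Polynomial.coeff_C_mul_X_pow, Polynomial.eval_monomial]
  simp only [eq_comm]

/-- The restriction of a polynomial to the ray `(u, v) = (c t, t)`. -/
noncomputable def restrictRay (P : MvPolynomial (Fin 2) ℚ) (c : ℚ) : Polynomial ℚ :=
  ∑ m ∈ P.support, Polynomial.C (P.coeff m * c ^ m 0) * Polynomial.X ^ (m 0 + m 1)

theorem eval_restrictRay (P : MvPolynomial (Fin 2) ℚ) (c t : ℚ) :
    (restrictRay P c).eval t = eval ![c * t, t] P := by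
  rw [eval_pair_eq, restrictRay, Polynomial.eval_finsetSum]
  refine Finset.sum_congr rfl fun m _ => ?_
  simp only [Polynomial.eval_mul, Polynomial.eval_C, Polynomial.eval_pow, Polynomial.eval_X]
  ring

/-- The homogeneous part of total degree `n`, dehomogenized by `v = 1`. -/
noncomputable def topPart (P : MvPolynomial (Fin 2) ℚ) (n : ℕ) : Polynomial ℚ :=
  ∑ m ∈ P.support with m 0 + m 1 = n, Polynomial.monomial (m 0) (P.coeff m)

theorem coeff_topPart (P : MvPolynomial (Fin 2) ℚ) (i j : ℕ) :
    (topPart P (i + j)).coeff i = P.coeff (expPair i j) := by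
  rw [topPart, Polynomial.finsetSum_coeff]
  simp only [Polynomial.coeff_monomial]
  rw [← Finset.sum_filter, Finset.filter_filter]
  by_cases h : P.coeff (expPair i j) = 0
  · rw [h]
    refine Finset.sum_eq_zero fun m hm => ?_
    obtain ⟨-, h1, rfl⟩ := Finset.mem_filter.1 hm
    obtain rfl := Nat.add_left_cancel h1
    rwa [expPair_self] at h
  · rw [Finset.sum_eq_single (expPair i j)]
    · intro m hm hne
      obtain ⟨-, h1, rfl⟩ := Finset.mem_filter.1 hm
      obtain rfl := Nat.add_left_cancel h1
      exact absurd (expPair_self m).symm hne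
    · intro hm
      simp [h] at hm

theorem coeff_restrictRay (P : MvPolynomial (Fin 2) ℚ) (c : ℚ) (n : ℕ) :
    (restrictRay P c).coeff n = (topPart P n).eval c := by
  rw [restrictRay, topPart, Polynomial.finsetSum_coeff, Polynomial.eval_finsetSum,
    Finset.sum_filter]
  refine Finset.sum_congr rfl fun m _ => ?_
  rw [Polynomial.coeff_C_mul_X_pow, Polynomial.eval_monomial]
  simp only [eq_comm]

/-- Along the ray `(c t, t)` the bounds force degree at most `deg Q` in `t`. The coefficient of
`t^n` is the part of `P` of degree `n` evaluated at `(c, 1)`; vanishing for infinitely many `c`,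
that part is zero. -/
theorem coeff_eq_zero_of_le_poly {P : MvPolynomial (Fin 2) ℚ} {Q : Polynomial ℚ} {d u₀ v₀ : ℕ}
    (h : ∀ u v : ℕ, d * v + u₀ ≤ u → v₀ ≤ v →
      0 ≤ eval ![(u : ℚ), (v : ℚ)] P ∧ eval ![(u : ℚ), (v : ℚ)] P ≤ Q.eval (u : ℚ))
    {i j : ℕ} (hij : Q.natDegree < i + j) : P.coeff (expPair i j) = 0 := by
  have htop : topPart P (i + j) = 0 := by
    apply eq_of_eventually_eval_eq
    -- For `c > d` the ray eventually stays in the region `u ≥ dv + u₀`.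
    filter_upwards [eventually_ge_atTop (d + 1)] with c hc
    rw [← coeff_restrictRay, Polynomial.eval_zero]
    apply Polynomial.coeff_eq_zero_of_natDegree_lt
    refine lt_of_le_of_lt ?_ hij
    calc (restrictRay P c).natDegree ≤ (Q.comp (Polynomial.C (c : ℚ) * Polynomial.X)).natDegree := by
          apply natDegree_le_of_eventually_le
          filter_upwards [eventually_ge_atTop (u₀ + v₀)] with t ht
          have h1 : d * t + u₀ ≤ c * t := by
            have := Nat.mul_le_mul_right t hc
            rw [Nat.add_mul] at this
            lia
          have h2 := h (c * t) t h1 (by lia)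
          rw [eval_restrictRay]
          push_cast at h2
          simpa using h2
      _ = Q.natDegree := by
          rw [Polynomial.natDegree_comp, Polynomial.natDegree_C_mul_X _ (by
            have : 0 < c := by lia
            exact_mod_cast this.ne'), mul_one]
  rw [← coeff_topPart, htop, Polynomial.coeff_zero]

/-- A polynomial with the growth properties of the Hilbert polynomial of the Rees algebra has
the same degree and the same leading coefficient in `u` as the bounding polynomial. -/
theorem degrees_eq_of_bounds {P : MvPolynomial (Fin 2) ℚ} {Q : Polynomial ℚ} {d u₀ v₀ : ℕ}
    (hQ : Q ≠ 0)
    (h : ∀ u v : ℕ, d * v + u₀ ≤ u → v₀ ≤ v →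
      0 ≤ eval ![(u : ℚ), (v : ℚ)] P ∧ eval ![(u : ℚ), (v : ℚ)] P ≤ Q.eval (u : ℚ))
    (hv : ∀ v : ℕ, v₀ ≤ v → ∃ R : Polynomial ℚ, (R = 0 ∨ R.natDegree < Q.natDegree) ∧
      ∀ᶠ u : ℕ in atTop, Q.eval (u : ℚ) = R.eval (u : ℚ) + eval ![(u : ℚ), (v : ℚ)] P) :
    P ≠ 0 ∧ P.totalDegree = Q.natDegree ∧ P.degreeOf 0 = Q.natDegree ∧
      P.coeff (expPair Q.natDegree 0) = Q.leadingCoeff := by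
  -- For each large `v` the coefficient of `u ^ deg Q` in `P(u, v)` is that of `Q`, since `R` has
  -- smaller degree. As a polynomial in `v` it is therefore constant.
  have hlead : coeffU P Q.natDegree = Polynomial.C Q.leadingCoeff := by
    apply eq_of_eventually_eval_eq
    filter_upwards [eventually_ge_atTop v₀] with v hv'
    obtain ⟨R, hR, hRe⟩ := hv v hv'
    have e : Q = R + restrictV P v := by
      apply eq_of_eventually_eval_eq
      filter_upwards [hRe] with u hu
      rw [hu, Polynomial.eval_add, eval_restrictV]
    rw [← coeff_restrictV, Polynomial.eval_C, Polynomial.leadingCoeff]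
    conv_rhs => rw [e, Polynomial.coeff_add, ← e]
    have : R.coeff Q.natDegree = 0 := by
      rcases hR with rfl | hR
      · simp
      · exact Polynomial.coeff_eq_zero_of_natDegree_lt hR
    rw [this, zero_add]
  have hc : P.coeff (expPair Q.natDegree 0) = Q.leadingCoeff := by
    rw [← coeff_coeffU, hlead, Polynomial.coeff_C_zero]
  have hc0 : P.coeff (expPair Q.natDegree 0) ≠ 0 := by
    rw [hc]
    exact Polynomial.leadingCoeff_ne_zero.2 hQ
  have hsupp : ∀ m ∈ P.support, m 0 + m 1 ≤ Q.natDegree := by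
    intro m hm
    by_contra! hlt
    refine mem_support_iff.1 hm ?_
    rw [← expPair_self m]
    exact coeff_eq_zero_of_le_poly h hlt
  have htot : P.totalDegree ≤ Q.natDegree := by
    refine Finset.sup_le fun m hm => ?_
    rw [Finsupp.sum_fintype _ _ (by simp), Fin.sum_univ_two]
    exact hsupp m hm
  have hdeg : Q.natDegree ≤ P.degreeOf 0 := by
    have := monomial_le_degreeOf 0 (mem_support_iff.2 hc0)
    simpa using this
  refine ⟨?_, le_antisymm htot (hdeg.trans (degreeOf_le_totalDegree P 0)),
    le_antisymm ((degreeOf_le_totalDegree P 0).trans htot) hdeg, hc⟩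
  rintro rfl
  simp at hc0

theorem fwdDiff_pow_of_le {i p : ℕ} (h : p ≤ i) (x : ℚ) :
    ∑ a ∈ Finset.range (i + 1), ((-1 : ℚ) ^ (i - a) * (i.choose a : ℚ)) * (x + a) ^ p =
      if p = i then (i.factorial : ℚ) else 0 := by
  have e := fwdDiff_iter_eq_sum_shift (1 : ℚ) (fun r : ℚ => r ^ p) i x
  have e' : (fwdDiff (1 : ℚ))^[i] (fun r : ℚ => r ^ p) x =
      if p = i then (i.factorial : ℚ) else 0 := by
    split_ifs with hp
    · subst hp
      rw [fwdDiff_iter_eq_factorial]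
      rfl
    · rw [fwdDiff_iter_pow_eq_zero_of_lt (lt_of_le_of_ne h hp)]
      rfl
  rw [← e', e]
  refine Finset.sum_congr rfl fun a _ => ?_
  simp

/-- The normalized coefficients of top degree of a polynomial which takes integer values
at all large points are integers. -/
theorem exists_int_of_integer_valued {P : MvPolynomial (Fin 2) ℚ} {d u₀ v₀ : ℕ}
    (h : ∀ u v : ℕ, d * v + u₀ ≤ u → v₀ ≤ v →
      ∃ z : ℤ, eval ![(u : ℚ), (v : ℚ)] P = z)
    {i j : ℕ} (hP : P.totalDegree ≤ i + j) :
    ∃ z : ℤ, (i.factorial : ℚ) * (j.factorial : ℚ) * P.coeff (expPair i j) = z := by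
  -- Base point such that every `(u + a, v₀ + b)` with `b ≤ j` lies in the region of integrality.
  set u : ℕ := d * (v₀ + j) + u₀ with hu
  have hint : ∀ a b : ℕ, ∃ z : ℤ, b ≤ j →
      eval ![((u : ℚ) + a), ((v₀ : ℚ) + b)] P = z := by
    intro a b
    by_cases hb : b ≤ j
    · obtain ⟨z, hz⟩ := h (u + a) (v₀ + b) (by
        have := Nat.mul_le_mul_left d (Nat.add_le_add_left hb v₀)
        lia) (by lia)
      exact ⟨z, fun _ => by rw [← hz]; push_cast; rfl⟩
    · exact ⟨0, fun h => absurd h hb⟩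
  choose z hz using hint
  -- The mixed difference of order `i` in `u` and `j` in `v`, an integer combination of values of
  -- `P`. It kills every monomial of total degree at most `i + j` other than `u^i v^j`, since such a
  -- monomial has exponent below `i` in `u` or below `j` in `v`.
  refine ⟨∑ a ∈ Finset.range (i + 1), ∑ b ∈ Finset.range (j + 1),
    ((-1) ^ (i - a) * (i.choose a : ℤ)) * ((-1) ^ (j - b) * (j.choose b : ℤ)) * z a b, ?_⟩
  push_cast
  have e1 : ∑ a ∈ Finset.range (i + 1), ∑ b ∈ Finset.range (j + 1),
      ((-1 : ℚ) ^ (i - a) * (i.choose a : ℚ)) * ((-1) ^ (j - b) * (j.choose b : ℚ)) * z a b =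
      ∑ m ∈ P.support, P.coeff m *
        ((∑ a ∈ Finset.range (i + 1), ((-1 : ℚ) ^ (i - a) * (i.choose a : ℚ)) *
          ((u : ℚ) + a) ^ m 0) *
        (∑ b ∈ Finset.range (j + 1), ((-1 : ℚ) ^ (j - b) * (j.choose b : ℚ)) *
          ((v₀ : ℚ) + b) ^ m 1)) := by
    simp_rw [Finset.sum_mul_sum, Finset.mul_sum]
    rw [Finset.sum_comm]
    rw [Finset.sum_comm (s := P.support)]
    rw [Finset.sum_comm]
    refine Finset.sum_congr rfl fun a _ => ?_
    rw [Finset.sum_comm]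
    refine Finset.sum_congr rfl fun b hb => ?_
    rw [← hz a b (Nat.lt_succ_iff.1 (Finset.mem_range.1 hb)), eval_pair_eq, Finset.mul_sum]
    refine Finset.sum_congr rfl fun m _ => ?_
    ring
  rw [e1]
  have e2 : ∀ m ∈ P.support, P.coeff m *
        ((∑ a ∈ Finset.range (i + 1), ((-1 : ℚ) ^ (i - a) * (i.choose a : ℚ)) *
          ((u : ℚ) + a) ^ m 0) *
        (∑ b ∈ Finset.range (j + 1), ((-1 : ℚ) ^ (j - b) * (j.choose b : ℚ)) *
          ((v₀ : ℚ) + b) ^ m 1)) =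
      if m = expPair i j then (i.factorial : ℚ) * (j.factorial : ℚ) * P.coeff m else 0 := by
    intro m hm
    have hle : m 0 + m 1 ≤ i + j := by
      have := le_totalDegree hm
      rw [Finsupp.sum_fintype _ _ (by simp), Fin.sum_univ_two] at this
      exact this.trans hP
    split_ifs with hme
    · rw [hme, expPair_zero, expPair_one, fwdDiff_pow_of_le le_rfl, fwdDiff_pow_of_le le_rfl,
        if_pos rfl, if_pos rfl]
      ring
    · by_cases h0 : m 0 < i
      · rw [fwdDiff_pow_of_le h0.le, if_neg h0.ne, zero_mul, mul_zero]
      · have h1 : m 1 < j := by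
          by_contra h1
          refine hme ?_
          rw [← expPair_self m]
          congr 1 <;> lia
        rw [fwdDiff_pow_of_le h1.le, if_neg h1.ne, mul_zero, mul_zero]
  rw [Finset.sum_congr rfl e2, Finset.sum_ite_eq']
  split_ifs with hm
  · rfl
  · rw [notMem_support_iff.1 hm, mul_zero]

end PolynomialAnalysis

/-! ### Bigraded presentation of the Rees algebra -/

section Rees

variable {k A : Type*} [Field k] [CommRing A] [Algebra k A]

/-- The component `(I^v)_u t^v` as a subspace of `A[t]`. -/
noncomputable def reesPiece (𝒜 : ℕ → Submodule k A) (I : Ideal A) (i : ℕ × ℕ) :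
    Submodule k (Polynomial A) :=
  (𝒜 i.1 ⊓ (I ^ i.2).restrictScalars k).map
    ((Polynomial.monomial i.2 : A →ₗ[A] Polynomial A).restrictScalars k)

theorem mem_reesPiece {𝒜 : ℕ → Submodule k A} {I : Ideal A} {i : ℕ × ℕ} {q : Polynomial A} :
    q ∈ reesPiece 𝒜 I i ↔ ∃ a ∈ 𝒜 i.1, a ∈ I ^ i.2 ∧ Polynomial.monomial i.2 a = q := by
  simp [reesPiece, Submodule.mem_map, and_assoc]

theorem reesHilbert_eq (𝒜 : ℕ → Submodule k A) (I : Ideal A) (u v : ℕ) :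
    reesHilbert 𝒜 I u v =
      Module.finrank k (𝒜 u ⊓ (I ^ v).restrictScalars k : Submodule k A) := by
  have hinj : Function.Injective
      ((reesAlgebra I).val.toLinearMap.restrictScalars k : reesAlgebra I →ₗ[k] Polynomial A) :=
    Subtype.val_injective
  have hinj' : Function.Injective
      ((Polynomial.monomial v : A →ₗ[A] Polynomial A).restrictScalars k) :=
    Polynomial.monomial_injective v
  rw [reesHilbert, (Submodule.equivMapOfInjective _ hinj _).finrank_eq,
    (Submodule.equivMapOfInjective _ hinj' (𝒜 u ⊓ (I ^ v).restrictScalars k)).finrank_eq]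
  suffices heq : (reesComponent 𝒜 I u v).map
      ((reesAlgebra I).val.toLinearMap.restrictScalars k) =
      (𝒜 u ⊓ (I ^ v).restrictScalars k).map
        ((Polynomial.monomial v : A →ₗ[A] Polynomial A).restrictScalars k) by
    rw [heq]
  ext q
  constructor
  · rintro ⟨⟨p, hp⟩, ⟨a, ha, hap⟩, rfl⟩
    have hap' : Polynomial.monomial v a = p := hap
    subst hap'
    exact ⟨a, ⟨ha, reesAlgebra.monomial_mem.1 hp⟩, rfl⟩
  · rintro ⟨a, ⟨ha, haI⟩, rfl⟩
    exact ⟨⟨Polynomial.monomial v a, reesAlgebra.monomial_mem.2 haI⟩, ⟨a, ha, rfl⟩, rfl⟩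

instance gradedMonoid_reesPiece (𝒜 : ℕ → Submodule k A) [SetLike.GradedMonoid 𝒜] (I : Ideal A) :
    SetLike.GradedMonoid (reesPiece 𝒜 I) where
  one_mem := mem_reesPiece.2 ⟨1, SetLike.one_mem_graded 𝒜, by simp, rfl⟩
  mul_mem := by
    intro i j p q hp hq
    obtain ⟨a, ha, haI, rfl⟩ := mem_reesPiece.1 hp
    obtain ⟨b, hb, hbI, rfl⟩ := mem_reesPiece.1 hq
    refine mem_reesPiece.2 ⟨a * b, SetLike.mul_mem_graded ha hb, ?_, ?_⟩
    · rw [Prod.snd_add, pow_add]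
      exact Ideal.mul_mem_mul haI hbI
    · rw [Polynomial.monomial_mul_monomial, Prod.snd_add]

open MvPolynomial

variable {σ κ : Type*}

/-- The bidegrees of the variables of a polynomial ring mapping onto the Rees algebra. -/
def reesWeight (σ : Type*) {κ : Type*} (δ : κ → ℕ) : σ ⊕ κ → ℕ × ℕ :=
  Sum.elim (fun _ => (1, 0)) (fun j => (δ j, 1))

theorem weight_reesWeight [Fintype σ] [Fintype κ] (δ : κ → ℕ) (m : σ ⊕ κ →₀ ℕ) :
    Finsupp.weight (reesWeight σ δ) m =
      (∑ i, m (Sum.inl i) + ∑ j, m (Sum.inr j) * δ j, ∑ j, m (Sum.inr j)) := by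
  rw [Finsupp.weight_apply, Finsupp.sum_fintype _ _ (by simp), Fintype.sum_sum_type]
  ext <;> simp [reesWeight, Prod.fst_sum, Prod.snd_sum]

/-- The exponents of the `X_i` are bounded by the first degree and those of the `T_j` by the second,
so generators `f_j` of degree `0` cause no trouble. -/
theorem finiteDimensional_reesWeight [Fintype σ] [Fintype κ] (δ : κ → ℕ) (i : ℕ × ℕ) :
    FiniteDimensional k (weightedHomogeneousSubmodule k (reesWeight σ δ) i) := by
  have hle : weightedHomogeneousSubmodule k (reesWeight σ δ) i ≤
      restrictDegree (σ ⊕ κ) k (i.1 + i.2) := by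
    intro p hp
    rw [mem_restrictDegree]
    intro m hm a
    have hw := hp (mem_support_iff.1 hm)
    rw [weight_reesWeight] at hw
    subst hw
    rcases a with a | a
    · have := Finset.single_le_sum (f := fun i => m (Sum.inl i)) (fun _ _ => Nat.zero_le _)
        (Finset.mem_univ a)
      simp only at this ⊢
      lia
    · have := Finset.single_le_sum (f := fun i => m (Sum.inr i)) (fun _ _ => Nat.zero_le _)
        (Finset.mem_univ a)
      simp only at this ⊢
      lia
  exact Submodule.finiteDimensional_of_le hle

theorem mem_span_range_inr [Fintype σ] [Fintype κ] (δ : κ → ℕ) (u v : ℕ)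
    {p : MvPolynomial (σ ⊕ κ) k}
    (hp : p ∈ weightedHomogeneousSubmodule k (reesWeight σ δ) (u, v + 1)) :
    p ∈ Ideal.span (Set.range fun j : κ => (X (Sum.inr j) : MvPolynomial (σ ⊕ κ) k)) := by
  have e : (Set.range fun j : κ => (X (Sum.inr j) : MvPolynomial (σ ⊕ κ) k)) =
      X '' Set.range Sum.inr := by
    rw [← Set.range_comp]
    rfl
  rw [e, mem_ideal_span_X_image]
  intro m hm
  have hw := hp (mem_support_iff.1 hm)
  rw [weight_reesWeight, Prod.mk.injEq] at hw
  by_contra! hne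
  have : ∑ j, m (Sum.inr j) = 0 := Finset.sum_eq_zero fun j _ => hne _ ⟨j, rfl⟩
  lia

/-- A monomial in the `T_j` alone of second degree `v` has first degree at most `d v`; beyond that
bound some `X_i` must occur. -/
theorem mem_span_range_inl [Fintype σ] [Fintype κ] (δ : κ → ℕ) {d : ℕ} (hd : ∀ j, δ j ≤ d)
    {u v : ℕ} (huv : d * v < u) {p : MvPolynomial (σ ⊕ κ) k}
    (hp : p ∈ weightedHomogeneousSubmodule k (reesWeight σ δ) (u, v)) :
    p ∈ Ideal.span (Set.range fun i : σ => (X (Sum.inl i) : MvPolynomial (σ ⊕ κ) k)) := by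
  have e : (Set.range fun j : σ => (X (Sum.inl j) : MvPolynomial (σ ⊕ κ) k)) =
      X '' Set.range Sum.inl := by
    rw [← Set.range_comp]
    rfl
  rw [e, mem_ideal_span_X_image]
  intro m hm
  have hw := hp (mem_support_iff.1 hm)
  rw [weight_reesWeight, Prod.mk.injEq] at hw
  by_contra! hne
  have h0 : ∑ i, m (Sum.inl i) = 0 := Finset.sum_eq_zero fun j _ => hne _ ⟨j, rfl⟩
  have h1 : ∑ j, m (Sum.inr j) * δ j ≤ v * d := by
    rw [← hw.2, Finset.sum_mul]
    exact Finset.sum_le_sum fun j _ => Nat.mul_le_mul_left _ (hd j)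
  rw [mul_comm v d] at h1
  lia

/-- The presentation `k[X, T] → A[t]` of the Rees algebra, `X_i ↦ x_i`, `T_j ↦ f_j t`. -/
noncomputable def reesPresentation (k : Type*) {A σ κ : Type*} [Field k] [CommRing A] [Algebra k A]
    (x : σ → A) (f : κ → A) : MvPolynomial (σ ⊕ κ) k →ₐ[k] Polynomial A :=
  aeval (Sum.elim (fun i => Polynomial.C (x i)) (fun j => Polynomial.monomial 1 (f j)))

theorem mem_range_reesPresentation {x : σ → A} (hx : Algebra.adjoin k (Set.range x) = ⊤)
    {f : κ → A} {I : Ideal A} (hfI : Ideal.span (Set.range f) = I) {q : Polynomial A}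
    (hq : q ∈ reesAlgebra I) : q ∈ (reesPresentation k x f).range := by
  have hC : ∀ a : A, Polynomial.C a ∈ (reesPresentation k x f).range := by
    intro a
    have ha : a ∈ Algebra.adjoin k (Set.range x) := hx ▸ (Algebra.mem_top : a ∈ (⊤ : Subalgebra k A))
    induction ha using Algebra.adjoin_induction with
    | mem a ha =>
      obtain ⟨i, rfl⟩ := ha
      exact ⟨X (Sum.inl i), by simp [reesPresentation]⟩
    | algebraMap r => exact Subalgebra.algebraMap_mem _ r
    | add a b _ _ ha hb => rw [map_add]; exact add_mem ha hb
    | mul a b _ _ ha hb => rw [map_mul]; exact mul_mem ha hb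
  rw [← adjoin_monomial_eq_reesAlgebra] at hq
  induction hq using Algebra.adjoin_induction with
  | mem q hq =>
    obtain ⟨a, ha, rfl⟩ := hq
    rw [SetLike.mem_coe, ← hfI] at ha
    induction ha using Submodule.span_induction with
    | mem a ha =>
      obtain ⟨j, rfl⟩ := ha
      exact ⟨X (Sum.inr j), by simp [reesPresentation]⟩
    | zero => rw [map_zero]; exact zero_mem _
    | add a b _ _ ha hb => rw [map_add]; exact add_mem ha hb
    | smul b a _ ha =>
      rw [map_smul, ← Polynomial.C_mul']
      exact mul_mem (hC b) ha
  | algebraMap r => exact hC r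
  | add a b _ _ ha hb => exact add_mem ha hb
  | mul a b _ _ ha hb => exact mul_mem ha hb

variable (𝒜 : ℕ → Submodule k A) [GradedAlgebra 𝒜]

theorem reesPresentation_mem_reesPiece {x : σ → A} (hx : ∀ i, x i ∈ 𝒜 1) {f : κ → A} {δ : κ → ℕ}
    (hf : ∀ j, f j ∈ 𝒜 (δ j)) {I : Ideal A} (hfI : Ideal.span (Set.range f) = I) {i : ℕ × ℕ}
    {p : MvPolynomial (σ ⊕ κ) k}
    (hp : p ∈ weightedHomogeneousSubmodule k (reesWeight σ δ) i) :
    reesPresentation k x f p ∈ reesPiece 𝒜 I i := by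
  have hvar : ∀ a, reesPresentation k x f (X a) ∈ reesPiece 𝒜 I (reesWeight σ δ a) := by
    rintro (a | a)
    · exact mem_reesPiece.2 ⟨x a, hx a, by simp [reesWeight], by
        simp [reesPresentation, reesWeight]⟩
    · refine mem_reesPiece.2 ⟨f a, hf a, ?_, by simp [reesPresentation, reesWeight]⟩
      simp only [reesWeight, Sum.elim_inr, pow_one]
      rw [← hfI]
      exact Ideal.subset_span ⟨a, rfl⟩
  have hmon : ∀ m : σ ⊕ κ →₀ ℕ, reesPresentation k x f (monomial m 1) ∈
      reesPiece 𝒜 I (Finsupp.weight (reesWeight σ δ) m) := by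
    intro m
    induction m using Finsupp.induction_linear with
    | zero =>
      rw [map_zero, show (monomial 0 1 : MvPolynomial (σ ⊕ κ) k) = 1 from rfl, map_one]
      exact SetLike.one_mem_graded (reesPiece 𝒜 I)
    | add m n hm hn =>
      have e : (monomial (m + n) 1 : MvPolynomial (σ ⊕ κ) k) = monomial m 1 * monomial n 1 := by
        rw [monomial_mul, one_mul]
      rw [e, map_mul, map_add]
      exact SetLike.mul_mem_graded hm hn
    | single a n =>
      rw [← X_pow_eq_monomial, map_pow, Finsupp.weight_single]
      exact SetLike.pow_mem_graded n (hvar a)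
  rw [p.as_sum, map_sum]
  refine sum_mem fun m hm => ?_
  have hw := hp (mem_support_iff.1 hm)
  have e : monomial m (p.coeff m) = p.coeff m • (monomial m 1 : MvPolynomial (σ ⊕ κ) k) := by
    rw [smul_monomial, smul_eq_mul, mul_one]
  rw [e, map_smul, ← hw]
  exact Submodule.smul_mem _ _ (hmon m)

attribute [local instance] MvPolynomial.weightedGradedAlgebra

/-- Compatibility of the presentation with bihomogeneous components, checked on homogeneous
elements; it makes the kernel homogeneous and lets preimages be replaced by their components. -/
theorem reesPresentation_decompose {x : σ → A} (hx : ∀ i, x i ∈ 𝒜 1) {f : κ → A} {δ : κ → ℕ}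
    (hf : ∀ j, f j ∈ 𝒜 (δ j)) {I : Ideal A} (hfI : Ideal.span (Set.range f) = I) (i : ℕ × ℕ)
    (p : MvPolynomial (σ ⊕ κ) k) :
    reesPresentation k x f
        (DirectSum.decompose (weightedHomogeneousSubmodule k (reesWeight σ δ)) p i) =
      Polynomial.monomial i.2
        (DirectSum.decompose 𝒜 ((reesPresentation k x f p).coeff i.2) i.1 : A) := by
  induction p using DirectSum.Decomposition.inductionOn
    (weightedHomogeneousSubmodule k (reesWeight σ δ)) with
  | zero => simp
  | @homogeneous j p =>
    obtain ⟨a, ha, -, hap⟩ := mem_reesPiece.1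
      (reesPresentation_mem_reesPiece 𝒜 hx hf hfI p.2)
    by_cases hij : j = i
    · subst hij
      rw [DirectSum.decompose_of_mem_same _ p.2, ← hap, Polynomial.coeff_monomial, if_pos rfl,
        DirectSum.decompose_of_mem_same 𝒜 ha]
    · rw [DirectSum.decompose_of_mem_ne _ p.2 hij, ← hap, Polynomial.coeff_monomial, map_zero]
      split_ifs with h2
      · have h1 : j.1 ≠ i.1 := fun h1 => hij (Prod.ext h1 h2)
        rw [DirectSum.decompose_of_mem_ne 𝒜 ha h1, map_zero]
      · simp
  | add p q hp hq =>
    simp only [DirectSum.decompose_add, DirectSum.add_apply, Submodule.coe_add, map_add,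
      Polynomial.coeff_add, hp, hq]

theorem isHomogeneous_ker_reesPresentation {x : σ → A} (hx : ∀ i, x i ∈ 𝒜 1) {f : κ → A}
    {δ : κ → ℕ} (hf : ∀ j, f j ∈ 𝒜 (δ j)) {I : Ideal A} (hfI : Ideal.span (Set.range f) = I) :
    (RingHom.ker (reesPresentation k x f)).IsHomogeneous
      (weightedHomogeneousSubmodule k (reesWeight σ δ)) := by
  intro i p hp
  rw [RingHom.mem_ker] at hp ⊢
  rw [reesPresentation_decompose 𝒜 hx hf hfI, hp]
  simp

theorem gradedHilbert_ker_reesPresentation {x : σ → A} (hx : ∀ i, x i ∈ 𝒜 1)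
    (hx' : Algebra.adjoin k (Set.range x) = ⊤) {f : κ → A}
    {δ : κ → ℕ} (hf : ∀ j, f j ∈ 𝒜 (δ j)) {I : Ideal A} (hfI : Ideal.span (Set.range f) = I)
    (u v : ℕ) :
    gradedHilbert (weightedHomogeneousSubmodule k (reesWeight σ δ))
      (RingHom.ker (reesPresentation k x f)) (u, v) = reesHilbert 𝒜 I u v := by
  have hinj' : Function.Injective
      ((Polynomial.monomial v : A →ₗ[A] Polynomial A).restrictScalars k) :=
    Polynomial.monomial_injective v
  rw [reesHilbert_eq, (Submodule.equivMapOfInjective _ hinj' _).finrank_eq, gradedHilbert,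
    finrank_map_eq_of_ker _ _ (reesPresentation k x f).toLinearMap]
  · suffices heq : (weightedHomogeneousSubmodule k (reesWeight σ δ) (u, v)).map
        (reesPresentation k x f).toLinearMap = (𝒜 u ⊓ (I ^ v).restrictScalars k).map
        ((Polynomial.monomial v : A →ₗ[A] Polynomial A).restrictScalars k) by
      rw [heq]
    apply le_antisymm
    · rintro _ ⟨p, hp, rfl⟩
      exact reesPresentation_mem_reesPiece 𝒜 hx hf hfI hp
    · rintro _ ⟨a, ⟨ha, haI⟩, rfl⟩
      obtain ⟨p, hp⟩ := mem_range_reesPresentation (k := k) hx' hfI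
        (reesAlgebra.monomial_mem.2 haI)
      refine ⟨DirectSum.decompose (weightedHomogeneousSubmodule k (reesWeight σ δ)) p (u, v),
        SetLike.coe_mem _, ?_⟩
      have hp' : reesPresentation k x f p = Polynomial.monomial v a := hp
      change reesPresentation k x f _ = Polynomial.monomial v a
      rw [reesPresentation_decompose 𝒜 hx hf hfI, hp', Polynomial.coeff_monomial, if_pos rfl,
        DirectSum.decompose_of_mem_same 𝒜 ha]
  · intro p _
    change Ideal.Quotient.mk _ p = 0 ↔ _
    rw [Ideal.Quotient.eq_zero_iff_mem, RingHom.mem_ker]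
    rfl

theorem exists_mvPolynomial_reesHilbert (hA : IsStandardGraded 𝒜) {κ : Type*} [Fintype κ]
    {f : κ → A} {δ : κ → ℕ} (hf : ∀ j, f j ∈ 𝒜 (δ j)) {I : Ideal A}
    (hfI : Ideal.span (Set.range f) = I) {d : ℕ} (hd : ∀ j, δ j ≤ d) :
    ∃ (P : MvPolynomial (Fin 2) ℚ) (u₀ v₀ : ℕ), ∀ u v : ℕ, d * v + u₀ ≤ u → v₀ ≤ v →
      (reesHilbert 𝒜 I u v : ℚ) = MvPolynomial.eval ![(u : ℚ), (v : ℚ)] P := by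
  obtain ⟨s, hs⟩ := Module.Finite.iff_fg.1 hA.finite_one
  have hx : ∀ i : s, (i : A) ∈ 𝒜 1 := fun i => by
    rw [← hs]
    exact Submodule.subset_span i.2
  have hx' : Algebra.adjoin k (Set.range (Subtype.val : s → A)) = ⊤ := by
    rw [eq_top_iff, ← hA.adjoin_one, Subtype.range_coe]
    refine Algebra.adjoin_le ?_
    rw [← hs]
    exact Algebra.span_le_adjoin k _
  have hfin := finiteDimensional_reesWeight (k := k) (σ := s) δ
  have hrow : ∀ J : Ideal (MvPolynomial (s ⊕ κ) k),
      J.IsHomogeneous (weightedHomogeneousSubmodule k (reesWeight s δ)) → ∀ v : ℕ,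
      ∃ Q : Polynomial ℚ, ∀ᶠ u : ℕ in atTop,
        (gradedHilbert (weightedHomogeneousSubmodule k (reesWeight s δ)) J (u, v) : ℚ) =
          Q.eval (u : ℚ) := by
    intro J hJ v
    have e : ∀ n : ℕ, ((0, v) + n • (1, 0) : ℕ × ℕ) = (n, v) := fun n => by simp
    obtain ⟨Q, hQ⟩ := exists_polynomial_gradedHilbert
      (weightedHomogeneousSubmodule k (reesWeight s δ)) hfin (1, 0) (0, v)
      (Set.range fun i : s => (X (Sum.inl i) : MvPolynomial (s ⊕ κ) k))
      (by
        rintro _ ⟨i, rfl⟩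
        exact isWeightedHomogeneous_X k (reesWeight s δ) (Sum.inl i))
      (eventually_atTop.2 ⟨d * v + 1, fun n hn b hb => by
        rw [e] at hb
        exact mem_span_range_inl δ hd (by lia) hb⟩) J hJ
    simp only [e] at hQ
    exact ⟨Q, hQ⟩
  obtain ⟨P, u₀, v₀, hP⟩ := exists_mvPolynomial_gradedHilbert
    (weightedHomogeneousSubmodule k (reesWeight s δ)) hfin
    (fun j : κ => (X (Sum.inr j) : MvPolynomial (s ⊕ κ) k)) δ
    (fun j => isWeightedHomogeneous_X k (reesWeight s δ) (Sum.inr j)) d hd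
    (fun u v b hb => mem_span_range_inr δ u v hb) hrow _
    (isHomogeneous_ker_reesPresentation 𝒜 hx hf hfI)
  refine ⟨P, u₀, v₀, fun u v hu hv => ?_⟩
  rw [← hP u v hu hv, gradedHilbert_ker_reesPresentation 𝒜 hx hx' hf hfI]

end Rees

/-! ### The ideal `0 : I^∞` -/

section ZeroColon

variable {A : Type*} [CommRing A]

theorem mem_zeroColonInfty {I : Ideal A} {a : A} :
    a ∈ zeroColonInfty I ↔ ∃ m : ℕ, ∀ b ∈ I ^ m, b * a = 0 := Iff.rfl

/-- The ideal is finitely generated, so the largest exponent needed for the generators is uniform.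
-/
theorem exists_pow_mul_zeroColonInfty [IsNoetherianRing A] (I : Ideal A) :
    ∃ m : ℕ, ∀ a ∈ zeroColonInfty I, ∀ b ∈ I ^ m, b * a = 0 := by
  obtain ⟨s, hs⟩ := IsNoetherian.noetherian (zeroColonInfty I)
  have h : ∀ a : s, ∃ m : ℕ, ∀ b ∈ I ^ m, b * (a : A) = 0 := fun a =>
    mem_zeroColonInfty.1 (hs ▸ Submodule.subset_span a.2)
  choose m hm using h
  refine ⟨Finset.univ.sup m, fun a ha b hb => ?_⟩
  rw [← hs] at ha
  induction ha using Submodule.span_induction with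
  | mem a ha =>
    exact hm ⟨a, ha⟩ b (Ideal.pow_le_pow_right (Finset.le_sup (Finset.mem_univ _)) hb)
  | zero => exact mul_zero b
  | add x y _ _ hx hy => rw [mul_add, hx, hy, add_zero]
  | smul c x _ hx => rw [smul_eq_mul, mul_left_comm, hx, mul_zero]

/-- Artin–Rees: `I^v ∩ J = I^(v-c) (I^c ∩ J) ⊆ I^m J = 0` once `v ≥ c + m`. -/
theorem exists_pow_inf_zeroColonInfty [IsNoetherianRing A] (I : Ideal A) :
    ∃ v₁ : ℕ, ∀ v, v₁ ≤ v → ∀ a ∈ I ^ v, a ∈ zeroColonInfty I → a = 0 := by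
  obtain ⟨m, hm⟩ := exists_pow_mul_zeroColonInfty I
  obtain ⟨c, hc⟩ := I.exists_pow_inf_eq_pow_smul (zeroColonInfty I : Submodule A A)
  refine ⟨c + m, fun v hv a ha haJ => ?_⟩
  have h1 : a ∈ I ^ v • (⊤ : Submodule A A) ⊓ zeroColonInfty I :=
    ⟨by simpa using ha, haJ⟩
  rw [hc v (by lia)] at h1
  have h2 : a ∈ I ^ m • (zeroColonInfty I : Submodule A A) :=
    Submodule.smul_mono (Ideal.pow_le_pow_right (by lia)) inf_le_right h1
  have h3 : I ^ m • (zeroColonInfty I : Submodule A A) ≤ ⊥ :=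
    Submodule.smul_le.2 fun b hb x hx => (Submodule.mem_bot A).2 (hm x hx b hb)
  exact (Submodule.mem_bot A).1 (h3 h2)

/-- In a Noetherian ring an ideal of zero divisors has a nonzero annihilator. But if `I a ⊆ J`, then
`I^(m+1) a ⊆ I^m J = 0`, so `a` already lies in `J`. -/
theorem exists_nonZeroDivisor_mem [IsNoetherianRing A] (I : Ideal A) :
    ∃ x ∈ I, Ideal.Quotient.mk (zeroColonInfty I) x ∈ nonZeroDivisors (A ⧸ zeroColonInfty I) := by
  set R := A ⧸ zeroColonInfty I
  set K : Ideal R := I.map (Ideal.Quotient.mk (zeroColonInfty I)) with hK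
  by_contra! hne
  have hdis : Disjoint (K : Set R) (nonZeroDivisors R) := by
    rw [Set.disjoint_left]
    intro y hy hy'
    obtain ⟨x, hx, rfl⟩ := (Ideal.mem_map_iff_of_surjective _ Ideal.Quotient.mk_surjective).1 hy
    exact hne x hx hy'
  obtain ⟨-, y, hy, hy0⟩ := SetLike.lt_iff_le_and_exists.1
    (Ideal.bot_lt_annihilator_of_disjoint_nonZeroDivisors hdis)
  obtain ⟨a, rfl⟩ := Ideal.Quotient.mk_surjective y
  refine hy0 ?_
  obtain ⟨m, hm⟩ := exists_pow_mul_zeroColonInfty I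
  have hIa : ∀ b ∈ I, b * a ∈ zeroColonInfty I := by
    intro b hb
    have h1 := Submodule.mem_annihilator.1 hy _ (Ideal.mem_map_of_mem _ hb)
    rw [smul_eq_mul, ← map_mul, Ideal.Quotient.eq_zero_iff_mem, mul_comm] at h1
    exact h1
  rw [Ideal.mem_bot, Ideal.Quotient.eq_zero_iff_mem]
  refine mem_zeroColonInfty.2 ⟨m + 1, fun b hb => ?_⟩
  rw [pow_succ] at hb
  induction hb using Submodule.mul_induction_on' with
  | mem_mul_mem c hc b hb => rw [mul_assoc]; exact hm _ (hIa b hb) c hc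
  | add x _ y _ hx hy => rw [add_mul, hx, hy, add_zero]

/-- A power of a nonzerodivisor is a nonzerodivisor, and this one vanishes in the smaller quotient.
-/
theorem ringKrullDim_quotient_sup_pow_add_one_le [IsNoetherianRing A] (I : Ideal A) (v : ℕ) :
    ringKrullDim (A ⧸ (zeroColonInfty I ⊔ I ^ v)) + 1 ≤
      ringKrullDim (A ⧸ zeroColonInfty I) := by
  obtain ⟨x, hx, hx'⟩ := exists_nonZeroDivisor_mem I
  refine ringKrullDim_succ_le_of_surjective
    (Ideal.Quotient.factor (le_sup_left : zeroColonInfty I ≤ zeroColonInfty I ⊔ I ^ v))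
    (Ideal.Quotient.factor_surjective _) (pow_mem hx' v) ?_
  rw [← map_pow, Ideal.Quotient.factor_mk, Ideal.Quotient.eq_zero_iff_mem]
  exact Ideal.mem_sup_right (Ideal.pow_mem_pow hx v)

variable {k : Type*} [Field k] [Algebra k A] (𝒜 : ℕ → Submodule k A) [GradedAlgebra 𝒜]

theorem isHomogeneous_pow {I : Ideal A} (hI : I.IsHomogeneous 𝒜) (v : ℕ) :
    (I ^ v).IsHomogeneous 𝒜 := by
  induction v with
  | zero => rw [pow_zero, Ideal.one_eq_top]; exact Ideal.IsHomogeneous.top 𝒜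
  | succ v ih => rw [pow_succ]; exact ih.mul hI

theorem isHomogeneous_zeroColonInfty {I : Ideal A} (hI : I.IsHomogeneous 𝒜) :
    (zeroColonInfty I).IsHomogeneous 𝒜 := by
  classical
  rintro i a ⟨m, hm⟩
  refine mem_zeroColonInfty.2 ⟨m, fun b hb => ?_⟩
  rw [← DirectSum.sum_support_decompose 𝒜 b, Finset.sum_mul]
  refine Finset.sum_eq_zero fun j _ => ?_
  rw [← DirectSum.coe_decompose_mul_add_of_left_mem 𝒜 (SetLike.coe_mem _),
    hm _ (isHomogeneous_pow 𝒜 hI m j hb)]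
  simp

/-- Since `J ∩ K = 0`, the sequence `0 → K → A/J → A/(J + K) → 0` is exact. Applied to `K = I^v`, it
relates the Rees algebra to `A/J`. -/
theorem gradedHilbert_eq_add_finrank {J K : Ideal A} (hJ : J.IsHomogeneous 𝒜)
    (hK : K.IsHomogeneous 𝒜) (hJK : ∀ a ∈ K, a ∈ J → a = 0) (u : ℕ)
    [FiniteDimensional k (𝒜 u)] :
    gradedHilbert 𝒜 J u = gradedHilbert 𝒜 (J ⊔ K) u +
      Module.finrank k (𝒜 u ⊓ K.restrictScalars k : Submodule k A) := by
  set V := (𝒜 u).map (Ideal.Quotient.mkₐ k J).toLinearMap with hV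
  set f : A ⧸ J →ₗ[k] A ⧸ (J ⊔ K) :=
    (Ideal.Quotient.factorₐ k (le_sup_left : J ≤ J ⊔ K)).toLinearMap with hf
  have hfm : ∀ b : A, f (Ideal.Quotient.mkₐ k J b) = Ideal.Quotient.mkₐ k (J ⊔ K) b :=
    fun b => rfl
  have h1 : V.map f = (𝒜 u).map (Ideal.Quotient.mkₐ k (J ⊔ K)).toLinearMap := by
    rw [hV, ← Submodule.map_comp]
    rfl
  have h2 : V ⊓ LinearMap.ker f = (𝒜 u ⊓ K.restrictScalars k).map
      (Ideal.Quotient.mkₐ k J).toLinearMap := by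
    ext x
    constructor
    · rintro ⟨⟨b, hb, rfl⟩, hx⟩
      have hx' : b ∈ J ⊔ K := Ideal.Quotient.eq_zero_iff_mem.1 (show
        Ideal.Quotient.mk (J ⊔ K) b = 0 from hx)
      obtain ⟨j, hj, y, hy, hjy⟩ := Submodule.mem_sup.1 hx'
      refine ⟨DirectSum.decompose 𝒜 y u, ⟨SetLike.coe_mem _, hK u hy⟩, ?_⟩
      have e : b = DirectSum.decompose 𝒜 j u + DirectSum.decompose 𝒜 y u := by
        rw [← DirectSum.decompose_of_mem_same 𝒜 hb, ← hjy, DirectSum.decompose_add]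
        simp
      have hj' : Ideal.Quotient.mkₐ k J (DirectSum.decompose 𝒜 j u) = 0 :=
        Ideal.Quotient.eq_zero_iff_mem.2 (hJ u hj)
      change Ideal.Quotient.mkₐ k J (DirectSum.decompose 𝒜 y u) = Ideal.Quotient.mkₐ k J b
      conv_rhs => rw [e, map_add, hj', zero_add]
    · rintro ⟨b, ⟨hb, hbK⟩, rfl⟩
      refine ⟨⟨b, hb, rfl⟩, ?_⟩
      change f (Ideal.Quotient.mkₐ k J b) = 0
      rw [hfm]
      exact Ideal.Quotient.eq_zero_iff_mem.2 (Ideal.mem_sup_right hbK)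
  have h3 := finrank_map_add_finrank_inf_ker V f
  rw [h1, h2] at h3
  rw [gradedHilbert, ← h3, gradedHilbert]
  congr 1
  rw [finrank_map_eq_of_ker _ _ LinearMap.id, Submodule.map_id]
  rintro x ⟨-, hx⟩
  change Ideal.Quotient.mk J x = 0 ↔ x = 0
  rw [Ideal.Quotient.eq_zero_iff_mem]
  exact ⟨hJK x hx, fun h => h ▸ J.zero_mem⟩

end ZeroColon

/-! ### Hilbert polynomials and the conventions for degenerate cases -/

section Main

variable {k A : Type*} [Field k] [CommRing A] [Algebra k A] {𝒜 : ℕ → Submodule k A}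
  [GradedAlgebra 𝒜]

theorem hilbertPolynomial_eq {H : ℕ → ℕ} {Q : Polynomial ℚ}
    (hQ : ∀ᶠ u : ℕ in atTop, (H u : ℚ) = Q.eval (u : ℚ)) : hilbertPolynomial H = Q := by
  have h : ∃ Q : Polynomial ℚ, ∀ᶠ u : ℕ in atTop, (H u : ℚ) = Q.eval (u : ℚ) := ⟨Q, hQ⟩
  rw [hilbertPolynomial, dif_pos h]
  apply eq_of_eventually_eval_eq
  filter_upwards [h.choose_spec, hQ] with u h1 h2
  rw [← h1, h2]

theorem hilbertPolynomial_eq_zero_of_subsingleton {k A : Type*} [Field k] [CommRing A]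
    [Algebra k A] {𝒜 : ℕ → Submodule k A} {J : Ideal A} [Subsingleton (A ⧸ J)]
    {Q : Polynomial ℚ}
    (hQ : ∀ᶠ n : ℕ in atTop, (gradedHilbert 𝒜 J n : ℚ) = Q.eval (n : ℚ)) : Q = 0 := by
  apply eq_of_eventually_eval_eq
  filter_upwards [hQ] with n hn
  rw [← hn, gradedHilbert_eq_zero, Nat.cast_zero, Polynomial.eval_zero]
  intro b _
  exact Ideal.Quotient.eq_zero_iff_mem.1 (Subsingleton.elim _ _)

/-- The convention that the zero ring has dimension `0` lets it share the case `Q = 0` with nonzero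
quotients of finite length. -/
theorem IsStandardGraded.krullDim_quotient_eq (hA : IsStandardGraded 𝒜) {J : Ideal A}
    (hJ : J.IsHomogeneous 𝒜) {Q : Polynomial ℚ}
    (hQ : ∀ᶠ n : ℕ in atTop, (gradedHilbert 𝒜 J n : ℚ) = Q.eval (n : ℚ)) :
    krullDim (A ⧸ J) = if Q = 0 then 0 else Q.natDegree + 1 := by
  rcases subsingleton_or_nontrivial (A ⧸ J) with h | h
  · rw [if_pos (hilbertPolynomial_eq_zero_of_subsingleton hQ), krullDim,
      ringKrullDim_eq_bot_of_subsingleton]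
    simp
  · rw [krullDim, hA.ringKrullDim_quotient_eq hJ hQ]
    split_ifs
    · rfl
    · rfl

end Main

end BigradedRees

/-! ### The main theorem -/

theorem theorem4p2 {k A : Type*} [Field k] [CommRing A] [Algebra k A]
    (𝒜 : ℕ → Submodule k A) [GradedAlgebra 𝒜] (hA : BigradedRees.IsStandardGraded 𝒜)
    (I : Ideal A) (hI : I.IsHomogeneous 𝒜)
    (r : ℕ) (f : Fin r → A) (δ : Fin r → ℕ) (hf : ∀ j, f j ∈ 𝒜 (δ j))
    (hfI : Ideal.span (Set.range f) = I)
    (d : ℕ) (hd : d = Finset.univ.sup δ)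
    (s : ℤ) (hs : s = (BigradedRees.krullDim (A ⧸ BigradedRees.zeroColonInfty I) : ℤ) - 1) :
    ∃ (P : MvPolynomial (Fin 2) ℚ) (u₀ v₀ : ℕ),
      (∀ u v : ℕ, d * v + u₀ ≤ u → v₀ ≤ v →
        (BigradedRees.reesHilbert 𝒜 I u v : ℚ) = MvPolynomial.eval ![(u : ℚ), (v : ℚ)] P) ∧
      BigradedRees.totalDeg P = s ∧
      BigradedRees.uDeg P = s ∧
      (0 ≤ s →
        (∀ i : ℕ, (i : ℤ) ≤ s → ∃ z : ℤ, BigradedRees.mixedMultiplicity P i = (z : ℚ)) ∧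
        BigradedRees.mixedMultiplicity P s.toNat =
          BigradedRees.quotientMultiplicity 𝒜 (BigradedRees.zeroColonInfty I)) := by
  open BigradedRees in
  have hnoeth := hA.isNoetherianRing
  have hfd := hA.finiteDimensional
  have hJ := isHomogeneous_zeroColonInfty 𝒜 hI
  have hJv : ∀ v, (zeroColonInfty I ⊔ I ^ v).IsHomogeneous 𝒜 := fun v =>
    hJ.sup (isHomogeneous_pow 𝒜 hI v)
  obtain ⟨Q, hQ⟩ := hA.exists_hilbertPolynomial hJ
  obtain ⟨v₁, hv₁⟩ := exists_pow_inf_zeroColonInfty I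
  have hsum : ∀ u v, v₁ ≤ v → gradedHilbert 𝒜 (zeroColonInfty I) u =
      gradedHilbert 𝒜 (zeroColonInfty I ⊔ I ^ v) u + reesHilbert 𝒜 I u v := fun u v hv => by
    rw [reesHilbert_eq]
    exact gradedHilbert_eq_add_finrank 𝒜 hJ (isHomogeneous_pow 𝒜 hI v) (hv₁ v hv) u
  obtain ⟨N, hN⟩ := Filter.eventually_atTop.1 hQ
  rw [hA.krullDim_quotient_eq hJ hQ] at hs
  by_cases hQ0 : Q = 0
  -- Here `s = -1`. The components of `I^v` embed in those of `A/J`, which vanish in large degrees,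
  -- so `P = 0` works.
  · rw [if_pos hQ0] at hs
    subst hQ0
    refine ⟨0, N, v₁, fun u v hu hv => ?_, by simp [totalDeg, hs], by simp [uDeg, hs],
      fun h => by simp [hs] at h⟩
    have h1 := hN u (by lia)
    rw [Polynomial.eval_zero, Nat.cast_eq_zero, hsum u v hv] at h1
    rw [map_zero, Nat.cast_eq_zero]
    lia
  rw [if_neg hQ0] at hs
  have hs' : s = (Q.natDegree : ℤ) := by rw [hs]; push_cast; ring
  subst hs'
  have hnt : Nontrivial (A ⧸ zeroColonInfty I) := by
    rw [← not_subsingleton_iff_nontrivial]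
    intro h
    exact hQ0 (hilbertPolynomial_eq_zero_of_subsingleton hQ)
  obtain ⟨P, u₀, v₀, hP⟩ := exists_mvPolynomial_reesHilbert 𝒜 hA hf hfI (d := d)
    (fun j => hd ▸ Finset.le_sup (Finset.mem_univ j))
  have hbound : ∀ u v : ℕ, d * v + (u₀ + N) ≤ u → v₀ + v₁ ≤ v →
      0 ≤ MvPolynomial.eval ![(u : ℚ), (v : ℚ)] P ∧
        MvPolynomial.eval ![(u : ℚ), (v : ℚ)] P ≤ Q.eval (u : ℚ) := by
    intro u v hu hv
    rw [← hP u v (by lia) (by lia), ← hN u (by lia), hsum u v (by lia)]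
    exact ⟨Nat.cast_nonneg _, by exact_mod_cast Nat.le_add_left _ _⟩
  have hrow : ∀ v : ℕ, v₀ + v₁ ≤ v → ∃ R : Polynomial ℚ, (R = 0 ∨ R.natDegree < Q.natDegree) ∧
      ∀ᶠ u : ℕ in Filter.atTop, Q.eval (u : ℚ) =
        R.eval (u : ℚ) + MvPolynomial.eval ![(u : ℚ), (v : ℚ)] P := by
    intro v hv
    obtain ⟨R, hR⟩ := hA.exists_hilbertPolynomial (hJv v)
    refine ⟨R, ?_, ?_⟩
    · rcases subsingleton_or_nontrivial (A ⧸ (zeroColonInfty I ⊔ I ^ v)) with h | h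
      · exact Or.inl (hilbertPolynomial_eq_zero_of_subsingleton hR)
      -- For `R = 0` the dimension is not `deg R + 1`, so this case is kept apart from the
      -- comparison of dimensions.
      · by_cases hR0 : R = 0
        · exact Or.inl hR0
        have h1 := ringKrullDim_quotient_sup_pow_add_one_le I v
        rw [hA.ringKrullDim_quotient_eq hJ hQ, hA.ringKrullDim_quotient_eq (hJv v) hR, if_neg hQ0, if_neg hR0] at h1
        have h2 : R.natDegree + 1 + 1 ≤ Q.natDegree + 1 := by exact_mod_cast h1
        exact Or.inr (by lia)
    · filter_upwards [hR, Filter.eventually_ge_atTop (d * v + (u₀ + N))] with u hu hu'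
      rw [← hu, ← hP u v (by lia) (by lia), ← hN u (by lia), hsum u v (by lia)]
      push_cast
      rfl
  obtain ⟨hP0, htot, hdeg, hcoeff⟩ := degrees_eq_of_bounds hQ0 hbound hrow
  refine ⟨P, u₀ + N, v₀ + v₁, fun u v hu hv => hP u v (by lia) (by lia), ?_, ?_, fun _ => ⟨?_, ?_⟩⟩
  · rw [totalDeg, if_neg hP0, htot]
  · rw [uDeg, if_neg hP0, hdeg]
  · intro i hi
    have hi' : i ≤ Q.natDegree := by exact_mod_cast hi
    rw [mixedMultiplicity, htot]
    refine exists_int_of_integer_valued (P := P) (d := d) (u₀ := u₀) (v₀ := v₀)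
      (fun u v hu hv => ⟨reesHilbert 𝒜 I u v, ?_⟩) (by lia)
    rw [← hP u v hu hv]
    rfl
  · have hHP : hilbertPolynomial (quotientHilbert 𝒜 (zeroColonInfty I)) = Q :=
      hilbertPolynomial_eq hQ
    rw [mixedMultiplicity, htot, Int.toNat_natCast, Nat.sub_self, Nat.factorial_zero,
      Nat.cast_one, mul_one, quotientMultiplicity]
    simp only [hHP]
    rw [if_neg hQ0, ← hcoeff]
    rfl
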